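/- An instance of bin packing with general cost structures (GCBP) consists of an integer $n\ge 1$, items $1,\dots,n$ with rational sizes $s_1,\dots,s_n\in[0,1]$, and a nondecreasing cost function $f:\{0,1,\dots,n\}\to\mathbb{Q}_{\ge 0}$ with $f(0)=0$ and $f(1)=1$. A feasible solution is a partition of the item set into subsets (bins), each of total size at most $1$; its cost is the sum of $f(|B|)$ over its bins $B$, and an optimal solution is a feasible solution of minimum cost. The sizes $s_1,\dots,s_n$ and the values $f(0),\dots,f(n)$ are the input, written in binary. Let $k$ be the smallest minimizer of $f(j)/j$ over $j\in\{1,\dots,n\}$. Theorem. Consider the instances with $k=2$. (i) Every such instance has an optimal solution in which every bin has cardinality $1$ or $2$, except for at most one bin, whose cardinality is odd and at least $3$. (ii) GCBP restricted to these instances is solvable in polynomial time: there is a deterministic algorithm that, on every instance with $k=2$, outputs an optimal solution in time bounded by a fixed polynomial in the length of the binary encoding of the instance. -/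

import Mathlib

/-! ### A model of computation with a bit-cost measure

Programs act on finite binary trees whose leaves are natural numbers. A number counts with its
binary length, and every elementary action is charged at least the total bit size of the data that
it reads and of the data that it writes. Hence a run of cost `t` can be simulated by a Turing
machine in a number of steps polynomial in `t`, so that polynomial cost implies polynomial time in
the usual sense. -/

namespace BitCost

/-- Finite binary trees with natural numbers at the leaves. -/
inductive Data : Type
  | num (n : ℕ) : Data
  | pair (a b : Data) : Data

namespace Data

/-- The bit size of a tree: each node counts `1` and each leaf additionally counts the binary
length of its number. -/
def size : Data → ℕ
  | num n => 1 + Nat.size n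
  | pair a b => 1 + size a + size b

/-- A list of trees as one tree: `nil` is the leaf `0`, and `cons` is `pair`. -/
def ofList : List Data → Data
  | [] => num 0
  | a :: l => pair a (ofList l)

end Data

/-- The elementary operations on trees. -/
inductive Op : Type
  | const (d : Data) : Op
  | fst : Op
  | snd : Op
  | isPair : Op
  | add : Op
  | sub : Op
  | mul : Op
  | div : Op

/-- The result of an elementary operation. The arithmetic operations act on a pair of numbers;
`sub` is truncated subtraction and `div` is the integer quotient (with quotient `0` for divisor
`0`). An operation applied to a tree of the wrong shape returns the leaf `0`. -/
def Op.apply : Op → Data → Data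
  | .const d, _ => d
  | .fst, .pair a _ => a
  | .snd, .pair _ b => b
  | .isPair, .pair _ _ => .num 1
  | .add, .pair (.num a) (.num b) => .num (a + b)
  | .sub, .pair (.num a) (.num b) => .num (a - b)
  | .mul, .pair (.num a) (.num b) => .num (a * b)
  | .div, .pair (.num a) (.num b) => .num (a / b)
  | _, _ => .num 0

/-- Programs: elementary operations, the identity, pairing, sequential composition, branching and
while-loops. -/
inductive Prog : Type
  | op (o : Op) : Prog
  | id : Prog
  | pair (p q : Prog) : Prog
  | seq (p q : Prog) : Prog
  | ite (c p q : Prog) : Prog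
  | loop (c p : Prog) : Prog

open Data in
/-- `Runs p x y t`: the program `p`, started on `x`, halts with result `y` at total cost `t`.
The program `seq p q` performs `p` first and then `q`; a test `c` of `ite c p q` or of
`loop c p` (while `c` holds, perform `p`) fails if it returns the leaf `0` and holds otherwise. -/
inductive Runs : Prog → Data → Data → ℕ → Prop
  | op (o : Op) (x : Data) :
      Runs (.op o) x (o.apply x) (1 + x.size + (o.apply x).size)
  | id (x : Data) :
      Runs .id x x (1 + x.size)
  | pair {p q : Prog} {x y z : Data} {t u : ℕ} :
      Runs p x y t → Runs q x z u →
        Runs (.pair p q) x (Data.pair y z) (1 + x.size + (Data.pair y z).size + t + u)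
  | seq {p q : Prog} {x y z : Data} {t u : ℕ} :
      Runs p x y t → Runs q y z u → Runs (.seq p q) x z (1 + t + u)
  | ite_true {c p q : Prog} {x v y : Data} {t u : ℕ} :
      Runs c x v t → v ≠ num 0 → Runs p x y u → Runs (.ite c p q) x y (1 + x.size + t + u)
  | ite_false {c p q : Prog} {x y : Data} {t u : ℕ} :
      Runs c x (num 0) t → Runs q x y u → Runs (.ite c p q) x y (1 + x.size + t + u)
  | loop_done {c p : Prog} {x : Data} {t : ℕ} :
      Runs c x (num 0) t → Runs (.loop c p) x x (1 + x.size + t)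
  | loop_step {c p : Prog} {x v y z : Data} {t u w : ℕ} :
      Runs c x v t → v ≠ num 0 → Runs p x y u → Runs (.loop c p) y z w →
        Runs (.loop c p) x z (1 + x.size + t + u + w)

/-- Programs are deterministic: the input determines the result and the cost. -/
theorem Runs.deterministic {p : Prog} {x y y' : Data} {t t' : ℕ}
    (h : Runs p x y t) (h' : Runs p x y' t') : y = y' ∧ t = t' := by
  induction h generalizing y' t' with
  | op o x => cases h'; exact ⟨rfl, rfl⟩
  | id x => cases h'; exact ⟨rfl, rfl⟩
  | pair _ _ ih₁ ih₂ =>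
    cases h' with
    | pair a b =>
      obtain ⟨rfl, rfl⟩ := ih₁ a
      obtain ⟨rfl, rfl⟩ := ih₂ b
      exact ⟨rfl, rfl⟩
  | seq _ _ ih₁ ih₂ =>
    cases h' with
    | seq a b =>
      obtain ⟨rfl, rfl⟩ := ih₁ a
      obtain ⟨rfl, rfl⟩ := ih₂ b
      exact ⟨rfl, rfl⟩
  | ite_true _ hv _ ih₁ ih₂ =>
    cases h' with
    | ite_true a _ b =>
      obtain ⟨rfl, rfl⟩ := ih₁ a
      obtain ⟨rfl, rfl⟩ := ih₂ b
      exact ⟨rfl, rfl⟩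
    | ite_false a _ => exact absurd (ih₁ a).1 hv
  | ite_false _ _ ih₁ ih₂ =>
    cases h' with
    | ite_true a hv _ => exact absurd (ih₁ a).1.symm hv
    | ite_false a b =>
      obtain ⟨-, rfl⟩ := ih₁ a
      obtain ⟨rfl, rfl⟩ := ih₂ b
      exact ⟨rfl, rfl⟩
  | loop_done _ ih₁ =>
    cases h' with
    | loop_done a =>
      obtain ⟨-, rfl⟩ := ih₁ a
      exact ⟨rfl, rfl⟩
    | loop_step a hv _ _ => exact absurd (ih₁ a).1.symm hv
  | loop_step _ hv _ _ ih₁ ih₂ ih₃ =>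
    cases h' with
    | loop_done a => exact absurd (ih₁ a).1 hv
    | loop_step a _ b c =>
      obtain ⟨rfl, rfl⟩ := ih₁ a
      obtain ⟨rfl, rfl⟩ := ih₂ b
      obtain ⟨rfl, rfl⟩ := ih₃ c
      exact ⟨rfl, rfl⟩

/-- The search problem "given an input `a ∈ dom`, produce some `b` with `sol a b`" is solvable in
polynomial time with respect to the encodings `encIn` and `encOut`: one program halts on every
input of `dom` with (the encoding of) a correct answer, at a cost that is bounded by a fixed
polynomial in the size of the encoded input. -/
def PolyTimeSolvable {α : Type} {β : α → Type} (encIn : α → Data)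
    (encOut : (a : α) → β a → Data) (dom : Set α) (sol : (a : α) → β a → Prop) : Prop :=
  ∃ (p : Prog) (P : Polynomial ℕ), ∀ a ∈ dom, ∃ (b : β a) (t : ℕ),
    sol a b ∧ Runs p (encIn a) (encOut a b) t ∧ t ≤ P.eval (encIn a).size

end BitCost

/-! ### Bin packing with general cost structures -/

namespace GCBP

open BitCost

/-- An instance: `n` items of rational sizes in `[0, 1]` and a rational cost function `f` on
cardinalities, nondecreasing on `{0, …, n}` (hence nonnegative there), with `f 0 = 0`, `f 1 = 1`.
The values of `f` beyond `n` are never used. -/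
structure Instance where
  n : ℕ
  s : Fin n → ℚ
  s_nonneg : ∀ i, 0 ≤ s i
  s_le_one : ∀ i, s i ≤ 1
  f : ℕ → ℚ
  f_mono : MonotoneOn f (Set.Iic n)
  f_zero : f 0 = 0
  f_one : f 1 = 1

namespace Instance

variable (I : Instance)

/-- A packing is a partition of the item set; its parts are the bins. -/
abbrev Packing : Type := Finpartition (Finset.univ : Finset (Fin I.n))

/-- Every bin has total size at most `1`. -/
def Feasible (P : I.Packing) : Prop := ∀ B ∈ P.parts, ∑ i ∈ B, I.s i ≤ 1

/-- The cost of a packing. -/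
def cost (P : I.Packing) : ℚ := ∑ B ∈ P.parts, I.f B.card

/-- A feasible packing of minimum cost. -/
def Optimal (P : I.Packing) : Prop :=
  I.Feasible P ∧ ∀ Q : I.Packing, I.Feasible Q → I.cost P ≤ I.cost Q

/-- The set of minimizers of `f j / j` over `j ∈ {1, …, n}`. -/
def minimizers : Set ℕ :=
  {j | j ∈ Set.Icc 1 I.n ∧ ∀ i ∈ Set.Icc 1 I.n, I.f j / (j : ℚ) ≤ I.f i / (i : ℚ)}

/-- A list of lists of items represents a packing if its entries list, each without repetition,
the bins of the packing, each bin exactly once. -/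
def Represents (L : List (List (Fin I.n))) (P : I.Packing) : Prop :=
  (∀ b ∈ L, b.Nodup) ∧
    ((L.map List.toFinset : List (Finset (Fin I.n))) : Multiset (Finset (Fin I.n))) = P.parts.val

/-- A nonnegative rational number, as the pair of its numerator and its denominator in binary. -/
def encodeRat (q : ℚ) : Data := .pair (.num q.num.natAbs) (.num q.den)

/-- The input: the list of the sizes `s 0, …, s (n - 1)` and the list of the costs
`f 0, …, f n`. -/
def encode : Data :=
  .pair (Data.ofList (List.ofFn fun i : Fin I.n => encodeRat (I.s i)))
    (Data.ofList (List.ofFn fun j : Fin (I.n + 1) => encodeRat (I.f j)))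

/-- The output: the list of the bins, each as the list of the indices of its items. -/
def encodeBins (L : List (List (Fin I.n))) : Data :=
  Data.ofList (L.map fun b => Data.ofList (b.map fun i => Data.num i))

end Instance

/-- The instances for which the smallest minimizer of `f j / j` over `{1, …, n}` is `k`. -/
def withMinimizer (k : ℕ) : Set Instance := {I | IsLeast I.minimizers k}

end GCBP

/-! ### Polynomial-time functions between encoded types -/

namespace BitCost

open Polynomial

/-! Pairs have the least cost per item, so splitting an even bin into pairs never costs more. Two
odd bins with at least three items each are dissolved together: each contains an item of at most
half the capacity, these two items fit into one bin, and what remains of either bin splits into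
pairs. Hence at most one odd bin with three or more items survives. This is `exists_special_form`;
applied to an optimal packing it gives (i).

For (ii), single out a bin `x :: B` such that all other bins have one or two items, and let `x` be
its largest item. Then every item of `B` is small, i.e. at most half the capacity. Sort the items
other than `x` by decreasing distance from half the capacity, with the tie rule of `key`. A small
item then fits together with a large one exactly if it precedes it. If `u` large items are packed
alone, they may be taken to be the first `u` large ones in this order. The other large items are
matched greedily with small ones, scanning from the end of the list. Any two small items fit
together, so the free ones are interchangeable outside the special bin, which therefore receives the
smallest of them.

The exchange argument is `greedy_spec`: under the counting condition supplied by `prefix_condition`,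
the greedy matching leaves at least as many free items as `B` has, and that many of them have at
most the total size of `B`. Counting singletons and pairs then shows that the resulting packing is
no more expensive (`exists_candidateAt`). Trying every `x`, every prefix containing the large
singletons, and every prefix of the free items gives polynomially many candidates, among which the
cheapest feasible one is optimal (`solve_spec`).

Sizes and costs are made integral with the product of the denominators, whose binary length is
polynomial in the input. The running time follows from closure properties of `PolyTime`; the
essential one is `PolyTime.foldl`, which requires a polynomial bound on the accumulators. -/

theorem Data.one_le_size (d : Data) : 1 ≤ d.size := by
  cases d <;> simp only [Data.size] <;> omega

/-- Writing the result is charged, so a time bound is also a bound on the output size. This is what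
makes polynomial bounds compose. -/
theorem Runs.size_le {p : Prog} {x y : Data} {t : ℕ} (h : Runs p x y t) : y.size ≤ t := by
  induction h <;> omega

theorem eval_mono (P : ℕ[X]) : Monotone fun m : ℕ => P.eval m := by
  intro a b hab
  induction P using Polynomial.induction_on' with
  | add p q hp hq => simpa only [eval_add] using add_le_add hp hq
  | monomial n c =>
    simp only [eval_monomial]
    exact Nat.mul_le_mul_left _ (Nat.pow_le_pow_left hab _)

/-- Types whose elements are represented by trees. -/
class Enc (α : Type) where
  enc : α → Data

instance : Enc ℕ := ⟨Data.num⟩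

instance : Enc Bool := ⟨fun b => Data.num b.toNat⟩

instance {α β : Type} [Enc α] [Enc β] : Enc (α × β) := ⟨fun x => Data.pair (Enc.enc x.1) (Enc.enc x.2)⟩

instance {α : Type} [Enc α] : Enc (List α) := ⟨fun l => Data.ofList (l.map Enc.enc)⟩

/-- The size of the encoding. -/
def esize {α : Type} [Enc α] (a : α) : ℕ := (Enc.enc a).size

/-! ### Sizes of encodings of pairs, lists and numbers. -/

section Sizes

variable {α β : Type} [Enc α] [Enc β]

theorem one_le_esize (a : α) : 1 ≤ esize a := Data.one_le_size _

theorem esize_pair (a : α) (b : β) : esize (a, b) = 1 + esize a + esize b := rfl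

theorem esize_nil : esize ([] : List α) = 1 := rfl

theorem esize_cons (a : α) (l : List α) : esize (a :: l) = 1 + esize a + esize l := rfl

theorem esize_nat (n : ℕ) : esize n = 1 + Nat.size n := rfl

theorem esize_append (l m : List α) : esize (l ++ m) + 1 = esize l + esize m := by
  induction l with
  | nil => rw [List.nil_append, esize_nil, Nat.add_comm]
  | cons a l ih => simp only [List.cons_append, esize_cons]; omega

theorem esize_perm {l m : List α} (h : l.Perm m) : esize l = esize m := by
  induction h with
  | nil => rfl
  | cons a _ ih => simp only [esize_cons, ih]
  | swap a b l => simp only [esize_cons]; omega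
  | trans _ _ ih₁ ih₂ => rw [ih₁, ih₂]

theorem length_lt_esize (l : List α) : l.length < esize l := by
  induction l with
  | nil => exact Nat.one_pos
  | cons a l ih => rw [List.length_cons, esize_cons]; have := one_le_esize a; omega

theorem esize_le_of_mem {a : α} {l : List α} (h : a ∈ l) : esize a ≤ esize l := by
  induction l with
  | nil => cases h
  | cons b l ih =>
    rw [esize_cons]
    rcases List.mem_cons.1 h with rfl | h
    · omega
    · have := ih h; omega

theorem esize_list_le {l : List α} {M : ℕ} (h : ∀ a ∈ l, esize a ≤ M) :
    esize l ≤ 1 + l.length * (1 + M) := by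
  induction l with
  | nil => simp [esize_nil]
  | cons a l ih =>
    rw [esize_cons, List.length_cons]
    have h1 := h a (by simp)
    have h2 := ih fun b hb => h b (by simp [hb])
    nlinarith

theorem esize_sublist {l m : List α} (h : l.Sublist m) : esize l ≤ esize m := by
  induction h with
  | slnil => exact le_rfl
  | cons a _ ih => rw [esize_cons]; omega
  | cons_cons a _ ih => rw [esize_cons, esize_cons]; omega

theorem size_add_le (a b : ℕ) : Nat.size (a + b) ≤ Nat.size a + Nat.size b + 1 := by
  rw [Nat.size_le]
  have ha := Nat.lt_size_self a
  have hb := Nat.lt_size_self b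
  have h1 : 2 ^ Nat.size a ≤ 2 ^ (Nat.size a + Nat.size b) := Nat.pow_le_pow_right (by simp) (by omega)
  have h2 : 2 ^ Nat.size b ≤ 2 ^ (Nat.size a + Nat.size b) := Nat.pow_le_pow_right (by simp) (by omega)
  rw [pow_succ]
  omega

theorem size_mul_le (a b : ℕ) : Nat.size (a * b) ≤ Nat.size a + Nat.size b := by
  rw [Nat.size_le, pow_add]
  exact Nat.mul_lt_mul'' (Nat.lt_size_self a) (Nat.lt_size_self b)

theorem size_le_self (n : ℕ) : Nat.size n ≤ n := by
  rw [Nat.size_le]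
  exact Nat.lt_two_pow_self

end Sizes

/-- Case distinction on a list. -/
def caseList {β γ : Type} (l : List β) (z : γ) (g : β → List β → γ) : γ :=
  match l with
  | [] => z
  | b :: t => g b t

/-- A function between encoded types that some program computes in polynomial time. -/
def PolyTime {α β : Type} [Enc α] [Enc β] (f : α → β) : Prop :=
  ∃ (p : Prog) (P : ℕ[X]), ∀ a, ∃ t, Runs p (Enc.enc a) (Enc.enc (f a)) t ∧ t ≤ P.eval (esize a)

/-! ### Closure properties of polynomial-time functions. -/

namespace PolyTime

variable {α β γ δ σ : Type} [Enc α] [Enc β] [Enc γ] [Enc δ] [Enc σ]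

theorem esize_bound {f : α → β} (hf : PolyTime f) :
    ∃ P : ℕ[X], ∀ a, esize (f a) ≤ P.eval (esize a) := by
  obtain ⟨p, P, h⟩ := hf
  refine ⟨P, fun a => ?_⟩
  obtain ⟨t, ht, hP⟩ := h a
  exact ht.size_le.trans hP

theorem comp {g : β → γ} {f : α → β} (hg : PolyTime g) (hf : PolyTime f) :
    PolyTime fun a => g (f a) := by
  obtain ⟨p, P, hp⟩ := hf
  obtain ⟨q, Q, hq⟩ := hg
  refine ⟨.seq p q, 1 + P + Q.comp P, fun a => ?_⟩
  obtain ⟨t, ht, htP⟩ := hp a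
  obtain ⟨u, hu, huQ⟩ := hq (f a)
  refine ⟨_, .seq ht hu, ?_⟩
  have := eval_mono Q (ht.size_le.trans htP)
  simp only [eval_add, eval_one, eval_comp] at this ⊢
  simp only [esize] at *
  omega

theorem of_op {f : α → β} (o : Op) (ho : ∀ a, o.apply (Enc.enc a) = Enc.enc (f a)) (Q : ℕ[X])
    (hQ : ∀ a, esize (f a) ≤ Q.eval (esize a)) : PolyTime f := by
  refine ⟨.op o, 1 + X + Q, fun a => ⟨_, ho a ▸ Runs.op o (Enc.enc a), ?_⟩⟩
  have := hQ a
  simp only [eval_add, eval_one, eval_X, ho, esize] at *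
  omega

theorem id : PolyTime fun a : α => a :=
  ⟨.id, 1 + X, fun a => ⟨_, .id _, by simp [esize]⟩⟩

theorem const (b : β) : PolyTime fun _ : α => b :=
  of_op (.const (Enc.enc b)) (fun _ => rfl) (C (esize b)) (by simp)

theorem fst : PolyTime fun x : α × β => x.1 :=
  of_op .fst (fun _ => rfl) X fun x => by rw [eval_X]; exact (by rw [esize_pair]; omega :
    esize x.1 ≤ esize (x.1, x.2))

theorem snd : PolyTime fun x : α × β => x.2 :=
  of_op .snd (fun _ => rfl) X fun x => by rw [eval_X]; exact (by rw [esize_pair]; omega :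
    esize x.2 ≤ esize (x.1, x.2))

theorem pair {f : α → β} {g : α → γ} (hf : PolyTime f) (hg : PolyTime g) :
    PolyTime fun a => (f a, g a) := by
  obtain ⟨p, P, hp⟩ := hf
  obtain ⟨q, Q, hq⟩ := hg
  refine ⟨.pair p q, 2 + X + 2 * P + 2 * Q, fun a => ?_⟩
  obtain ⟨t, ht, htP⟩ := hp a
  obtain ⟨u, hu, huQ⟩ := hq a
  refine ⟨_, .pair ht hu, ?_⟩
  have h1 := ht.size_le
  have h2 := hu.size_le
  simp only [eval_add, eval_mul, eval_ofNat, eval_X, esize, Data.size] at *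
  omega

theorem ite {c : α → Prop} [DecidablePred c] {f g : α → β} (hc : PolyTime fun a => decide (c a))
    (hf : PolyTime f) (hg : PolyTime g) : PolyTime fun a => if c a then f a else g a := by
  obtain ⟨r, R, hr⟩ := hc
  obtain ⟨p, P, hp⟩ := hf
  obtain ⟨q, Q, hq⟩ := hg
  refine ⟨.ite r p q, 1 + X + R + P + Q, fun a => ?_⟩
  obtain ⟨v, hv, hvR⟩ := hr a
  obtain ⟨t, ht, htP⟩ := hp a
  obtain ⟨u, hu, huQ⟩ := hq a
  by_cases h : c a
  · simp only [h, if_true, decide_true] at hv ⊢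
    refine ⟨_, .ite_true hv (by simp [Enc.enc]) ht, ?_⟩
    simp only [eval_add, eval_one, eval_X, esize] at *
    omega
  · simp only [h, if_false, decide_false] at hv ⊢
    refine ⟨_, .ite_false hv hu, ?_⟩
    simp only [eval_add, eval_one, eval_X, esize] at *
    omega

theorem comp₂ {g : β → γ → δ} {f : α → β} {f' : α → γ} (hg : PolyTime fun x : β × γ => g x.1 x.2)
    (hf : PolyTime f) (hf' : PolyTime f') : PolyTime fun a => g (f a) (f' a) :=
  hg.comp (hf.pair hf')

/-! #### Arithmetic -/

theorem add {f g : α → ℕ} (hf : PolyTime f) (hg : PolyTime g) : PolyTime fun a => f a + g a :=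
  comp₂ (of_op .add (fun _ => rfl) X fun x => by
    have := size_add_le x.1 x.2
    rw [eval_X]; change _ ≤ 1 + esize x.1 + esize x.2
    simp only [esize_nat]; omega) hf hg

theorem mul {f g : α → ℕ} (hf : PolyTime f) (hg : PolyTime g) : PolyTime fun a => f a * g a :=
  comp₂ (of_op .mul (fun _ => rfl) X fun x => by
    have := size_mul_le x.1 x.2
    rw [eval_X]; change _ ≤ 1 + esize x.1 + esize x.2
    simp only [esize_nat]; omega) hf hg

theorem sub {f g : α → ℕ} (hf : PolyTime f) (hg : PolyTime g) : PolyTime fun a => f a - g a :=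
  comp₂ (of_op .sub (fun _ => rfl) X fun x => by
    have := Nat.size_le_size (Nat.sub_le x.1 x.2)
    rw [eval_X]; change _ ≤ 1 + esize x.1 + esize x.2
    simp only [esize_nat]; omega) hf hg

theorem div {f g : α → ℕ} (hf : PolyTime f) (hg : PolyTime g) : PolyTime fun a => f a / g a :=
  comp₂ (of_op .div (fun _ => rfl) X fun x => by
    have := Nat.size_le_size (Nat.div_le_self x.1 x.2)
    rw [eval_X]; change _ ≤ 1 + esize x.1 + esize x.2
    simp only [esize_nat]; omega) hf hg

theorem eqZero {f : α → ℕ} (hf : PolyTime f) : PolyTime fun a => decide (f a = 0) := by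
  refine comp (g := fun n : ℕ => decide (n = 0)) ⟨.ite .id (.op (.const (.num 0)))
    (.op (.const (.num 1))), C 6 + C 6 * X, fun n => ?_⟩ hf
  have hs : Nat.size 1 = 1 := Nat.size_one
  by_cases h : n = 0
  · subst h
    refine ⟨_, .ite_false (.id _) (.op _ _), ?_⟩
    simp only [eval_add, eval_mul, eval_C, eval_X, esize, Op.apply, Data.size, Enc.enc]
    omega
  · simp only [decide_eq_false h]
    refine ⟨_, .ite_true (.id _) (by simpa [Enc.enc] using h) (.op _ _), ?_⟩
    simp only [eval_add, eval_mul, eval_C, eval_X, esize, Op.apply, Data.size, Enc.enc,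
      Nat.size_zero]
    omega

theorem le {f g : α → ℕ} (hf : PolyTime f) (hg : PolyTime g) :
    PolyTime fun a => decide (f a ≤ g a) := by
  simpa only [Nat.sub_eq_zero_iff_le] using (hf.sub hg).eqZero

theorem not {c : α → Prop} [DecidablePred c] (hc : PolyTime fun a => decide (c a)) :
    PolyTime fun a => decide (¬ c a) := by
  have := hc.ite (const (α := α) false) (const true)
  convert this using 2 with a
  by_cases h : c a <;> simp [h]

theorem lt {f g : α → ℕ} (hf : PolyTime f) (hg : PolyTime g) :
    PolyTime fun a => decide (f a < g a) := by
  simpa only [Nat.not_le] using (hg.le hf).not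

/-! #### Lists -/

theorem cons {f : α → β} {g : α → List β} (hf : PolyTime f) (hg : PolyTime g) :
    PolyTime fun a => f a :: g a :=
  hf.pair hg

theorem tail {f : α → List β} (hf : PolyTime f) : PolyTime fun a => (f a).tail :=
  comp (g := List.tail) (of_op .snd (by rintro (_ | ⟨b, l⟩) <;> rfl) X fun l => by
    rw [eval_X]; exact esize_sublist (List.tail_sublist l)) hf

/-- The empty list is a leaf and a nonempty list is a pair, so `isPair` is the test. A nonempty list
already has the shape of the pair of its head and tail, which `g` expects. -/
theorem listCases {l : α → List β} {f : α → γ} {g : α → β → List β → γ} (hl : PolyTime l)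
    (hf : PolyTime f) (hg : PolyTime fun x : α × β × List β => g x.1 x.2.1 x.2.2) :
    PolyTime fun a => caseList (l a) (f a) (g a) := by
  refine comp (g := fun x : α × List β => caseList x.2 (f x.1) (g x.1))
    ?_ (id.pair hl)
  obtain ⟨p, P, hp⟩ := hf.comp (fst (α := α) (β := List β))
  obtain ⟨q, Q, hq⟩ := hg
  refine ⟨.ite (.seq (.op .snd) (.op .isPair)) q p, 20 + 8 * X + P + Q, ?_⟩
  have hs : Nat.size 1 = 1 := Nat.size_one
  rintro ⟨a, _ | ⟨b, t⟩⟩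
  · obtain ⟨u, hu, huP⟩ := hp (a, [])
    refine ⟨_, .ite_false (.seq (.op _ _) (.op _ _)) hu, ?_⟩
    simp only [eval_add, eval_mul, eval_ofNat, eval_X]
    simp only [esize, Op.apply, Data.size, Enc.enc, Data.ofList, List.map, Nat.size_zero] at *
    omega
  · obtain ⟨u, hu, huQ⟩ := hq (a, b, t)
    refine ⟨_, .ite_true (v := .num 1) (.seq (.op _ _) (.op .isPair _)) (by simp) hu, ?_⟩
    simp only [eval_add, eval_mul, eval_ofNat, eval_X]
    simp only [esize, Op.apply, Data.size, Enc.enc, Data.ofList, List.map] at *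
    omega

/-- The loop that performs `p` as long as the list component of `(a, l, c)` is not empty. -/
def listLoop (p : Prog) : Prog :=
  .loop (.seq (.op .snd) (.seq (.op .fst) (.op .isPair))) p

/-- The hypotheses are indexed by the splittings of `l`, so that the bound `M` is needed only for
states that the loop really reaches. -/
theorem runs_listLoop {step : α → σ → β → σ} {p : Prog} {a : α} {M : ℕ} (l : List β) (c : σ)
    (hp : ∀ pre b suf, l = pre ++ b :: suf → ∃ t,
      Runs p (Enc.enc (a, b :: suf, pre.foldl (step a) c))
        (Enc.enc (a, suf, step a (pre.foldl (step a) c) b)) t ∧ t ≤ M)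
    (hM : ∀ pre suf, l = pre ++ suf → esize (a, suf, pre.foldl (step a) c) ≤ M) :
    ∃ t, Runs (listLoop p) (Enc.enc (a, l, c)) (Enc.enc (a, ([] : List β), l.foldl (step a) c)) t ∧
      t ≤ (l.length + 1) * (20 + 8 * M) := by
  have hs : Nat.size 1 = 1 := Nat.size_one
  induction l generalizing c with
  | nil =>
    refine ⟨_, .loop_done (.seq (.op _ _) (.seq (.op _ _) (.op .isPair _))), ?_⟩
    have := hM [] [] rfl
    simp only [List.foldl_nil, List.length_nil, esize, Enc.enc, Data.size, Op.apply, List.map,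
      Data.ofList, Nat.size_zero] at *
    omega
  | cons b l ih =>
    obtain ⟨t, ht, htM⟩ := hp [] b l rfl
    obtain ⟨u, hu, huM⟩ := ih (step a c b)
      (fun pre b' suf h => by simpa using hp (b :: pre) b' suf (by simp [h]))
      (fun pre suf h => by simpa using hM (b :: pre) suf (by simp [h]))
    refine ⟨_, .loop_step (v := .num 1) (.seq (.op _ _) (.seq (.op _ _) (.op .isPair _)))
      (by simp) ht hu, ?_⟩
    have := hM [] (b :: l) rfl
    rw [List.length_cons, Nat.succ_mul]
    simp only [List.foldl_nil, esize, Enc.enc, Data.size, Op.apply, List.map,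
      Data.ofList] at *
    omega

/-- The bound `hb` on the intermediate accumulators is essential: iterating a polynomial-time step
could double the size in each round. -/
theorem foldl {l : α → List β} {init : α → σ} {step : α → σ → β → σ} (hl : PolyTime l)
    (hi : PolyTime init) (hs : PolyTime fun x : α × σ × β => step x.1 x.2.1 x.2.2)
    (hb : ∃ Q : ℕ[X], ∀ a pre, pre <+: l a →
      esize (pre.foldl (step a) (init a)) ≤ Q.eval (esize a)) :
    PolyTime fun a => (l a).foldl (step a) (init a) := by
  let body : α × List β × σ → α × List β × σ := fun x =>
    caseList x.2.1 x fun b t => (x.1, t, step x.1 x.2.2 b)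
  have hbody : PolyTime body := by
    refine listCases (l := fun x : α × List β × σ => x.2.1) (f := fun x => x)
      (g := fun x b t => (x.1, t, step x.1 x.2.2 b)) (fst.comp snd) id ?_
    have h1 : PolyTime fun x : (α × List β × σ) × β × List β => x.1.1 := fst.comp fst
    exact h1.pair ((snd.comp snd).pair (hs.comp (h1.pair
      ((snd.comp (snd.comp fst)).pair (fst.comp snd)))))
  obtain ⟨Q, hQ⟩ := hb
  obtain ⟨p, P, hp⟩ := hbody
  obtain ⟨L, hL⟩ := hl.esize_bound
  -- `S` bounds the loop states: two pair nodes, the parameter, the remaining list and the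
  -- accumulator. `M` adds the cost of one execution of the body.
  let S : ℕ[X] := 2 + X + L + Q
  let M : ℕ[X] := S + P.comp S
  have hloop : PolyTime fun a => (a, ([] : List β), (l a).foldl (step a) (init a)) := by
    obtain ⟨r, R, hr⟩ := id.pair (hl.pair hi)
    refine ⟨.seq r (listLoop p), 1 + R + (L + 1) * (20 + 8 * M), fun a => ?_⟩
    obtain ⟨t, ht, htR⟩ := hr a
    have hS : ∀ pre suf, l a = pre ++ suf →
        esize (a, suf, pre.foldl (step a) (init a)) ≤ S.eval (esize a) := by
      intro pre suf h
      have h1 := hQ a pre ⟨suf, h.symm⟩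
      have h2 : esize suf ≤ esize (l a) := esize_sublist (h ▸ List.sublist_append_right _ _)
      have h3 := hL a
      simp only [esize_pair, S, eval_add, eval_ofNat, eval_X]
      omega
    obtain ⟨u, hu, huM⟩ := runs_listLoop (step := step) (p := p) (a := a) (M := M.eval (esize a))
      (l a) (init a)
      (fun pre b suf h => by
        obtain ⟨t, ht, htP⟩ := hp (a, b :: suf, pre.foldl (step a) (init a))
        refine ⟨t, ht, htP.trans ?_⟩
        have := eval_mono P (hS pre (b :: suf) h)
        simp only [M, eval_add, eval_comp] at this ⊢
        omega)
      (fun pre suf h => by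
        have := hS pre suf h
        simp only [M, eval_add]
        omega)
    refine ⟨_, .seq ht hu, ?_⟩
    have h1 : (l a).length ≤ L.eval (esize a) := (length_lt_esize (l a)).le.trans (hL a)
    have h2 : ((l a).length + 1) * (20 + 8 * M.eval (esize a)) ≤
        (L.eval (esize a) + 1) * (20 + 8 * M.eval (esize a)) := Nat.mul_le_mul_right _ (by omega)
    simp only [eval_add, eval_mul, eval_one, eval_ofNat]
    omega
  exact snd.comp (snd.comp hloop)

theorem reverse {l : α → List β} (hl : PolyTime l) : PolyTime fun a => (l a).reverse := by
  have h : PolyTime fun a => (l a).foldl (fun c b => b :: c) [] := by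
    obtain ⟨L, hL⟩ := hl.esize_bound
    refine foldl (step := fun _ c b => b :: c) hl (const _) ((snd.comp snd).cons (fst.comp snd))
      ⟨L, fun a pre h => ?_⟩
    have h1 : pre.foldl (fun c b => b :: c) [] = pre.reverse := by
      simp [List.foldl_flip_cons_eq_append]
    rw [h1, esize_perm (List.reverse_perm pre)]
    exact (esize_sublist h.sublist).trans (hL a)
  convert h using 2 with a
  simp [List.foldl_flip_cons_eq_append]

theorem foldr {l : α → List β} {init : α → σ} {step : α → β → σ → σ} (hl : PolyTime l)
    (hi : PolyTime init) (hs : PolyTime fun x : α × β × σ => step x.1 x.2.1 x.2.2)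
    (hb : ∃ Q : ℕ[X], ∀ a suf, suf <:+ l a →
      esize (suf.foldr (step a) (init a)) ≤ Q.eval (esize a)) :
    PolyTime fun a => (l a).foldr (step a) (init a) := by
  obtain ⟨Q, hQ⟩ := hb
  have := foldl (step := fun a c b => step a b c) hl.reverse hi
    (hs.comp (fst.pair ((snd.comp snd).pair (fst.comp snd)))) ⟨Q, fun a pre h => by
      have := hQ a pre.reverse (by simpa using List.reverse_suffix.2 h)
      rwa [List.foldr_reverse] at this⟩
  simpa only [List.foldl_reverse] using this

/-- A fold all of whose steps increase the size of the accumulator by a bounded amount. -/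
theorem foldr' {l : α → List β} {init : α → σ} {step : α → β → σ → σ} (hl : PolyTime l)
    (hi : PolyTime init) (hs : PolyTime fun x : α × β × σ => step x.1 x.2.1 x.2.2)
    (hb : ∃ Q : ℕ[X], ∀ a b c, b ∈ l a → esize (step a b c) ≤ esize c + Q.eval (esize a)) :
    PolyTime fun a => (l a).foldr (step a) (init a) := by
  obtain ⟨Q, hQ⟩ := hb
  obtain ⟨L, hL⟩ := hl.esize_bound
  obtain ⟨K, hK⟩ := hi.esize_bound
  refine foldr hl hi hs ⟨K + L * Q, fun a suf h => ?_⟩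
  have h1 : esize (suf.foldr (step a) (init a)) ≤
      esize (init a) + suf.length * Q.eval (esize a) := by
    have hmem : ∀ b ∈ suf, b ∈ l a := fun b hb => h.sublist.subset hb
    clear h
    induction suf with
    | nil => simp
    | cons b t ih =>
      have h1 := ih fun b hb => hmem b (by simp [hb])
      have h2 := hQ a b (t.foldr (step a) (init a)) (hmem b (by simp))
      rw [List.foldr_cons, List.length_cons, Nat.succ_mul]
      omega
  have h2 : suf.length ≤ L.eval (esize a) :=
    (h.sublist.length_le.trans (length_lt_esize (l a)).le).trans (hL a)
  have h3 := Nat.mul_le_mul_right (Q.eval (esize a)) h2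
  have h4 := hK a
  simp only [eval_add, eval_mul]
  omega

theorem append {f g : α → List β} (hf : PolyTime f) (hg : PolyTime g) :
    PolyTime fun a => f a ++ g a := by
  obtain ⟨P, hP⟩ := hf.esize_bound
  have := foldr' (step := fun _ b c => b :: c) hf hg ((fst.comp snd).cons (snd.comp snd))
    ⟨1 + P, fun a b c h => by
      have := hP a
      have := esize_le_of_mem h
      rw [esize_cons, eval_add, eval_one]; omega⟩
  simpa only [List.foldr_cons_eq_append'] using this

theorem map {l : α → List β} {g : α → β → γ} (hl : PolyTime l)
    (hg : PolyTime fun x : α × β => g x.1 x.2) : PolyTime fun a => (l a).map (g a) := by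
  obtain ⟨P, hP⟩ := hl.esize_bound
  obtain ⟨G, hG⟩ := hg.esize_bound
  have := foldr' (step := fun a b c => g a b :: c) hl (const [])
    ((hg.comp (fst.pair (fst.comp snd))).cons (snd.comp snd))
    ⟨1 + G.comp (1 + X + P), fun a b c h => by
      have h1 := hG (a, b)
      have h2 := hP a
      have h3 := esize_le_of_mem h
      have h4 := eval_mono G (show esize (a, b) ≤ 1 + esize a + P.eval (esize a) by
        rw [esize_pair]; omega)
      simp only [esize_cons, eval_add, eval_one, eval_comp, eval_X] at *; omega⟩
  convert this using 2 with a
  induction l a with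
  | nil => rfl
  | cons b t ih => rw [List.map_cons, List.foldr_cons, ih]

theorem flatten {l : α → List (List β)} (hl : PolyTime l) : PolyTime fun a => (l a).flatten := by
  obtain ⟨P, hP⟩ := hl.esize_bound
  have := foldr' (step := fun _ b c => b ++ c) hl (const [])
    ((fst.comp snd).append (snd.comp snd))
    ⟨P, fun a b c h => by
      have := hP a
      have := esize_le_of_mem h
      have := esize_append b c
      omega⟩
  convert this using 2 with a
  induction l a with
  | nil => rfl
  | cons b t ih => rw [List.flatten_cons, List.foldr_cons, ih]

theorem flatMap {l : α → List β} {g : α → β → List γ} (hl : PolyTime l)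
    (hg : PolyTime fun x : α × β => g x.1 x.2) : PolyTime fun a => (l a).flatMap (g a) :=
  (hl.map hg).flatten

theorem filter {l : α → List β} {p : α → β → Prop} [∀ a, DecidablePred (p a)] (hl : PolyTime l)
    (hp : PolyTime fun x : α × β => decide (p x.1 x.2)) :
    PolyTime fun a => (l a).filter (fun b => decide (p a b)) := by
  have := hl.flatMap (g := fun a b => if p a b then [b] else [])
    (ite (c := fun x : α × β => p x.1 x.2) hp (snd.cons (const [])) (const []))
  convert this using 2 with a
  induction l a with
  | nil => rfl
  | cons b t ih =>
    rw [List.filter_cons, List.flatMap_cons, ih]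
    by_cases h : p a b <;> simp [h]

theorem sum {l : α → List ℕ} (hl : PolyTime l) : PolyTime fun a => (l a).sum := by
  obtain ⟨P, hP⟩ := hl.esize_bound
  exact foldr' (step := fun _ b c => b + c) hl (const 0) ((fst.comp snd).add (snd.comp snd))
    ⟨P, fun a b c h => by
      have := hP a
      have := esize_le_of_mem h
      have := size_add_le b c
      simp only [esize_nat] at *
      omega⟩

theorem prod {l : α → List ℕ} (hl : PolyTime l) : PolyTime fun a => (l a).prod := by
  obtain ⟨P, hP⟩ := hl.esize_bound
  exact foldr' (step := fun _ b c => b * c) hl (const 1) ((fst.comp snd).mul (snd.comp snd))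
    ⟨P, fun a b c h => by
      have := hP a
      have := esize_le_of_mem h
      have := size_mul_le b c
      simp only [esize_nat] at *
      omega⟩

end PolyTime

end BitCost

/-! ### The algorithm -/

namespace GCBP

open BitCost
open Polynomial (eval_add eval_mul eval_one eval_ofNat)

/-- All ways to split a list into a prefix and a suffix. -/
def splits {α : Type} : List α → List (List α × List α)
  | [] => [([], [])]
  | a :: l => ([], a :: l) :: (splits l).map fun q => (a :: q.1, q.2)

theorem mem_splits {α : Type} {l : List α} {q : List α × List α} :
    q ∈ splits l ↔ q.1 ++ q.2 = l := by
  induction l generalizing q with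
  | nil => rcases q with ⟨a, b⟩; simp [splits]
  | cons a l ih =>
    rcases q with ⟨p, s⟩
    simp only [splits, List.mem_cons, List.mem_map, ih, Prod.mk.injEq, Prod.exists]
    cases p with
    | nil => simp
    | cons b p => simp [eq_comm, and_comm]

theorem length_splits {α : Type} (l : List α) : (splits l).length = l.length + 1 := by
  induction l with
  | nil => rfl
  | cons a l ih => simp [splits, ih]

/-- An item is its size (an integer) together with its label. -/
abbrev Item : Type := ℕ × ℕ

/-- The position of an item in the order of decreasing distance of its size from half the capacity
`C`; among items of the same distance, those that are at most half the capacity come first. -/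
def key (C : ℕ) (e : Item) : ℕ := if C < 2 * e.1 then 2 * e.1 else 2 * (C - e.1) + 1

/-- Whether the size of an item exceeds half the capacity. -/
def isBig (C : ℕ) (e : Item) : Bool := decide (C < 2 * e.1)

/-- Whether the size of an item is at most half the capacity. -/
def isSmall (C : ℕ) (e : Item) : Bool := decide (¬ C < 2 * e.1)

/-- Insertion sort by decreasing keys. -/
def sortItems (C : ℕ) (l : List Item) : List Item :=
  l.foldr (fun a c => c.filter (fun b => decide (key C a < key C b)) ++
    a :: c.filter (fun b => decide (¬ key C a < key C b))) []

/-- One step of the greedy matching. The state consists of the unmatched large items, the pairs, and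
the free small items. -/
def greedyStep (C : ℕ) (e : Item) (c : List Item × List (List Item) × List Item) :
    List Item × List (List Item) × List Item :=
  if C < 2 * e.1 then (e :: c.1, c.2)
  else caseList c.1 ([], c.2.1, e :: c.2.2) fun z t => (t, [e, z] :: c.2.1, c.2.2)

/-- The greedy matching of large items with small items. -/
def greedy (C : ℕ) (l : List Item) : List Item × List (List Item) × List Item :=
  l.foldr (greedyStep C) ([], [], [])

/-- One step of `pairUp`. -/
def pairStep (e : Item) (c : List Item × List (List Item)) : List Item × List (List Item) :=
  caseList c.1 ([e], c.2) fun z t => (t, [e, z] :: c.2)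

/-- Split a list into bins with two items, except for one bin with one item if the length is odd. -/
def pairUp (l : List Item) : List (List Item) :=
  (l.foldr pairStep ([], [])).2 ++ (l.foldr pairStep ([], [])).1.map fun a => [a]

/-- The packing with the special bin `x :: q''.1`, where the large items in `q'.1` are packed
alone, `g` is the greedy matching of the other items and `q''` is a splitting of its free items. -/
def packingOf (C : ℕ) (x : Item) (q' : List Item × List Item)
    (g : List Item × List (List Item) × List Item) (q'' : List Item × List Item) :
    List (List Item) :=
  (x :: q''.1) :: ((q'.1.filter (isBig C) ++ g.1).map (fun a => [a]) ++
    (g.2.1 ++ pairUp q''.2))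

/-- The items that take part in the greedy matching. -/
def matchItems (C : ℕ) (q' : List Item × List Item) : List Item :=
  q'.1.filter (isSmall C) ++ q'.2

/-- The packings with the largest item `x` of the special bin, for the other items `r`. -/
def candidatesAt (C : ℕ) (x : Item) (r : List Item) : List (List (List Item)) :=
  (splits r).flatMap fun q' => (splits (greedy C (matchItems C q')).2.2).map fun q'' =>
    packingOf C x q' (greedy C (matchItems C q')) q''

/-- The packings among which the algorithm looks for the best one. -/
def candidates (C : ℕ) (l : List Item) : List (List (List Item)) :=
  (splits l).flatMap fun q => caseList q.2 [] fun x r => candidatesAt C x (q.1 ++ r)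

/-- The total size of a bin. -/
def weight (b : List Item) : ℕ := (b.map fun e => e.1).sum

/-- The total excess of the bins. -/
def excess (C : ℕ) (L : List (List Item)) : ℕ := (L.map fun b => weight b - C).sum

/-- The cost of a list of bins, for the list `g` of the costs of the cardinalities. -/
def listCost (g : List ℕ) (L : List (List Item)) : ℕ :=
  (L.map fun b => caseList (b.foldr (fun _ c => c.tail) g) 0 fun a _ => a).sum

/-- A cheapest feasible candidate, or the packing with `n` bins. -/
def best (C : ℕ) (g : List ℕ) (l : List Item) : List (List Item) :=
  ((candidates C (sortItems C l)).filter fun L => decide (excess C L = 0)).foldr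
    (fun L M => if listCost g L ≤ listCost g M then L else M) (l.map fun a => [a])

/-- Multiply a list of fractions with the product of the denominators. -/
def scale (l : List (ℕ × ℕ)) : List ℕ :=
  l.map fun q => q.1 * ((l.map fun q => q.2).prod / q.2)

/-- The algorithm. -/
def solve (x : List (ℕ × ℕ) × List (ℕ × ℕ)) : List (List ℕ) :=
  (best (x.1.map fun q => q.2).prod (scale x.2) (scale x.1).zipIdx).map fun b => b.map fun e => e.2

/-! #### The algorithm runs in polynomial time -/

section PolyTime

variable {α β : Type} [Enc α] [Enc β]

open PolyTime

/-- There are `l.length + 1` splittings, each of which stores the entries of `l` once; the size is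
quadratic. -/
theorem esize_splits_le (l : List β) : esize (splits l) ≤ 1 + esize l * (3 + esize l) := by
  refine (esize_list_le (M := 2 + esize l) fun q hq => ?_).trans ?_
  · have h := esize_append q.1 q.2
    rw [mem_splits.1 hq] at h
    change 1 + esize q.1 + esize q.2 ≤ _
    omega
  · rw [length_splits]
    have h : (l.length + 1) * (1 + (2 + esize l)) ≤ esize l * (1 + (2 + esize l)) :=
      Nat.mul_le_mul_right _ (length_lt_esize l)
    rw [show 3 + esize l = 1 + (2 + esize l) by omega]
    omega

theorem polyTime_splits {l : α → List β} (hl : PolyTime l) : PolyTime fun a => splits (l a) := by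
  -- The recursion for `splits` also uses the tail itself, so the accumulator carries the suffix
  -- read so far.
  let step : α → β → List β × List (List β × List β) → List β × List (List β × List β) :=
    fun _ b c => (b :: c.1, ([], b :: c.1) :: c.2.map fun q => (b :: q.1, q.2))
  have hstep : ∀ (a : α) (m : List β), m.foldr (step a) ([], [([], [])]) = (m, splits m) := by
    intro a m
    induction m with
    | nil => rfl
    | cons b m ih => rw [List.foldr_cons, ih]; rfl
  obtain ⟨L, hL⟩ := hl.esize_bound
  have hs : PolyTime fun x : α × β × List β × List (List β × List β) => step x.1 x.2.1 x.2.2 := by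
    have h1 : PolyTime fun x : α × β × List β × List (List β × List β) => x.2.1 := fst.comp snd
    have h2 : PolyTime fun x : α × β × List β × List (List β × List β) => x.2.1 :: x.2.2.1 :=
      h1.cons (fst.comp (snd.comp snd))
    refine h2.pair (((const []).pair h2).cons (map (snd.comp (snd.comp snd)) ?_))
    exact ((h1.comp fst).cons (fst.comp snd)).pair (snd.comp snd)
  have := foldr (step := step) hl (const _) hs ⟨2 + L + L * (3 + L), fun a suf h => by
    rw [hstep a, esize_pair]
    have h1 := esize_splits_le suf
    have h2 : esize suf ≤ L.eval (esize a) := (esize_sublist h.sublist).trans (hL a)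
    have h3 : esize suf * (3 + esize suf) ≤ L.eval (esize a) * (3 + L.eval (esize a)) := by
      gcongr
    simp only [eval_add, eval_mul, eval_ofNat]
    omega⟩
  have h := snd.comp this
  simpa only [hstep] using h

theorem polyTime_zipIdx {l : α → List β} (hl : PolyTime l) : PolyTime fun a => (l a).zipIdx := by
  -- The accumulator is the running index together with the indexed list in reverse order.
  let step : α → ℕ × List (β × ℕ) → β → ℕ × List (β × ℕ) := fun _ c b => (c.1 + 1, (b, c.1) :: c.2)
  have hstep : ∀ (a : α) (m : List β), m.foldl (step a) (0, []) = (m.length, m.zipIdx.reverse) := by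
    intro a m
    induction m using List.reverseRecOn with
    | nil => rfl
    | append_singleton m b ih => simp [ih, step, List.zipIdx_append]
  obtain ⟨L, hL⟩ := hl.esize_bound
  have hs : PolyTime fun x : α × (ℕ × List (β × ℕ)) × β => step x.1 x.2.1 x.2.2 := by
    have h1 : PolyTime fun x : α × (ℕ × List (β × ℕ)) × β => x.2.1.1 := fst.comp (fst.comp snd)
    exact (h1.add (const 1)).pair (((snd.comp snd).pair h1).cons (snd.comp (fst.comp snd)))
  have := foldl (step := step) hl (const _) hs ⟨3 + L + L * (3 + 2 * L), fun a pre h => by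
    rw [hstep a, esize_pair, esize_perm (List.reverse_perm _)]
    have h2 : esize pre ≤ L.eval (esize a) := (esize_sublist h.sublist).trans (hL a)
    have h3 := length_lt_esize pre
    have h4 := size_le_self pre.length
    have h5 : esize pre.zipIdx ≤ 1 + pre.length * (1 + (2 + 2 * esize pre)) := by
      rw [← List.length_zipIdx (l := pre) (i := 0)]
      refine esize_list_le fun q hq => ?_
      have h6 : q.2 < pre.length := by
        have := List.snd_lt_add_of_mem_zipIdx hq; omega
      have h7 : q.1 ∈ pre := List.fst_mem_of_mem_zipIdx hq
      have h8 := esize_le_of_mem h7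
      have h9 := size_le_self q.2
      change 1 + esize q.1 + esize q.2 ≤ _
      rw [esize_nat q.2]
      omega
    have h6 : pre.length * (1 + (2 + 2 * esize pre)) ≤
        L.eval (esize a) * (3 + 2 * L.eval (esize a)) := Nat.mul_le_mul (by omega) (by omega)
    rw [esize_nat]
    simp only [eval_add, eval_mul, eval_ofNat]
    omega⟩
  have h := (snd.comp this).reverse
  simpa only [hstep, List.reverse_reverse] using h

theorem polyTime_big {C : α → ℕ} {e : α → Item} (hC : PolyTime C) (he : PolyTime e) :
    PolyTime fun a => decide (C a < 2 * (e a).1) :=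
  hC.lt ((const 2).mul (fst.comp he))

theorem polyTime_key {C : α → ℕ} {e : α → Item} (hC : PolyTime C) (he : PolyTime e) :
    PolyTime fun a => key (C a) (e a) :=
  PolyTime.ite (polyTime_big hC he) ((const 2).mul (fst.comp he))
    (((const 2).mul (hC.sub (fst.comp he))).add (const 1))

theorem polyTime_sortItems {C : α → ℕ} {l : α → List Item} (hC : PolyTime C) (hl : PolyTime l) :
    PolyTime fun a => sortItems (C a) (l a) := by
  obtain ⟨L, hL⟩ := hl.esize_bound
  have hc : PolyTime fun x : (α × Item × List Item) × Item =>
      decide (key (C x.1.1) x.1.2.1 < key (C x.1.1) x.2) :=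
    (polyTime_key (hC.comp (fst.comp fst)) (fst.comp (snd.comp fst))).lt
      (polyTime_key (hC.comp (fst.comp fst)) snd)
  refine foldr' (step := fun a b c => c.filter (fun b' => decide (key (C a) b < key (C a) b')) ++
    b :: c.filter (fun b' => decide (¬ key (C a) b < key (C a) b'))) hl (const [])
    ((filter (p := fun (x : α × Item × List Item) b' => key (C x.1) x.2.1 < key (C x.1) b')
      (snd.comp snd) hc).append ((fst.comp snd).cons
      (filter (p := fun (x : α × Item × List Item) b' => ¬ key (C x.1) x.2.1 < key (C x.1) b')
        (snd.comp snd) hc.not))) ⟨1 + L, fun a b c h => ?_⟩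
  -- The two filters are complementary, so their sizes together are that of `c`, and an insertion
  -- adds only the size of the new entry.
  have h1 := esize_append (c.filter (fun b' => decide (key (C a) b < key (C a) b')))
    (b :: c.filter (fun b' => decide (¬ key (C a) b < key (C a) b')))
  have h2 := esize_append (c.filter (fun b' => decide (key (C a) b < key (C a) b')))
    (c.filter (fun b' => decide (¬ key (C a) b < key (C a) b')))
  have h3 : (c.filter (fun b' => decide (key (C a) b < key (C a) b')) ++
    c.filter (fun b' => decide (¬ key (C a) b < key (C a) b'))).Perm c := by
      simpa only [decide_not] using
        List.filter_append_perm (fun b' => decide (key (C a) b < key (C a) b')) c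
  rw [esize_perm h3] at h2
  have h4 := hL a
  have h5 := esize_le_of_mem h
  rw [esize_cons] at h1
  rw [eval_add, eval_one]
  omega

theorem polyTime_greedy {C : α → ℕ} {l : α → List Item} (hC : PolyTime C) (hl : PolyTime l) :
    PolyTime fun a => greedy (C a) (l a) := by
  obtain ⟨L, hL⟩ := hl.esize_bound
  let T : Type := List Item × List (List Item) × List Item
  have hst : PolyTime fun x : α × Item × T => greedyStep (C x.1) x.2.1 x.2.2 := by
    have h1 : PolyTime fun x : α × Item × T => x.2.1 := fst.comp snd
    have h2 : PolyTime fun x : α × Item × T => x.2.2.1 := fst.comp (snd.comp snd)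
    have h3 : PolyTime fun x : α × Item × T => x.2.2.2.1 := fst.comp (snd.comp (snd.comp snd))
    have h4 : PolyTime fun x : α × Item × T => x.2.2.2.2 := snd.comp (snd.comp (snd.comp snd))
    refine PolyTime.ite (c := fun x : α × Item × T => C x.1 < 2 * x.2.1.1) (polyTime_big (hC.comp fst) h1)
      ((h1.cons h2).pair (snd.comp (snd.comp snd)))
      (listCases (g := fun x z t => (t, [x.2.1, z] :: x.2.2.2.1, x.2.2.2.2)) h2
        ((const []).pair (h3.pair (h1.cons h4))) ?_)
    exact (snd.comp snd).pair ((((h1.comp fst).cons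
      ((fst.comp snd).cons (const []))).cons (h3.comp fst)).pair (h4.comp fst))
  refine foldr' (step := fun a => greedyStep (C a)) hl (const ([], [], [])) hst
    ⟨5 + L, fun a b c h => ?_⟩
  have h4 := hL a
  have h5 := esize_le_of_mem h
  obtain ⟨s, p, f⟩ := c
  simp only [eval_add, eval_ofNat]
  unfold greedyStep
  split_ifs
  · simp only [esize_pair, esize_cons] at *
    omega
  · cases s <;> simp only [caseList, esize_pair, esize_cons, esize_nil] at * <;> omega

theorem polyTime_pairUp {l : α → List Item} (hl : PolyTime l) :
    PolyTime fun a => pairUp (l a) := by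
  obtain ⟨L, hL⟩ := hl.esize_bound
  let T : Type := List Item × List (List Item)
  have hst : PolyTime fun x : α × Item × T => pairStep x.2.1 x.2.2 := by
    have h1 : PolyTime fun x : α × Item × T => x.2.1 := fst.comp snd
    have h2 : PolyTime fun x : α × Item × T => x.2.2.1 := fst.comp (snd.comp snd)
    have h3 : PolyTime fun x : α × Item × T => x.2.2.2 := snd.comp (snd.comp snd)
    refine listCases (g := fun x z t => (t, [x.2.1, z] :: x.2.2.2)) h2
      ((h1.cons (const [])).pair h3) ?_
    exact (snd.comp snd).pair (((h1.comp fst).cons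
      ((fst.comp snd).cons (const []))).cons (h3.comp fst))
  have h : PolyTime fun a => (l a).foldr pairStep ([], []) := by
    refine foldr' (step := fun _ => pairStep) hl (const ([], [])) hst ⟨5 + L, fun a b c h => ?_⟩
    have h4 := hL a
    have h5 := esize_le_of_mem h
    obtain ⟨s, p⟩ := c
    simp only [eval_add, eval_ofNat]
    cases s <;> simp only [pairStep, caseList, esize_pair, esize_cons, esize_nil] at * <;> omega
  exact (snd.comp h).append (map (fst.comp h) (snd.cons (const [])))

theorem polyTime_candidatesAt {C : α → ℕ} {x : α → Item} {r : α → List Item} (hC : PolyTime C)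
    (hx : PolyTime x) (hr : PolyTime r) : PolyTime fun a => candidatesAt (C a) (x a) (r a) := by
  have hC' : PolyTime fun y : (α × List Item × List Item) × Item => C y.1.1 :=
    hC.comp (fst.comp fst)
  have hm : PolyTime fun y : α × List Item × List Item => greedy (C y.1) (matchItems (C y.1) y.2) := by
    have hf : PolyTime fun y : α × List Item × List Item =>
        y.2.1.filter (fun e => decide (¬ C y.1 < 2 * e.1)) :=
      filter (p := fun (y : α × List Item × List Item) e => ¬ C y.1 < 2 * e.1) (fst.comp snd)
        (polyTime_big hC' snd).not
    exact polyTime_greedy (hC.comp fst) (hf.append (snd.comp snd))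
  refine flatMap (g := fun a q' => (splits (greedy (C a) (matchItems (C a) q')).2.2).map fun q'' =>
    packingOf (C a) (x a) q' (greedy (C a) (matchItems (C a) q')) q'') (polyTime_splits hr) ?_
  refine map (g := fun (y : α × List Item × List Item) q'' =>
    packingOf (C y.1) (x y.1) y.2 (greedy (C y.1) (matchItems (C y.1) y.2)) q'')
    (polyTime_splits (snd.comp (snd.comp hm))) ?_
  have hm' := hm.comp (fst (α := α × List Item × List Item) (β := List Item × List Item))
  have hf : PolyTime fun y : α × List Item × List Item =>
      y.2.1.filter (fun e => decide (C y.1 < 2 * e.1)) :=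
    filter (p := fun (y : α × List Item × List Item) e => C y.1 < 2 * e.1) (fst.comp snd)
      (polyTime_big hC' snd)
  exact ((hx.comp (fst.comp fst)).cons (fst.comp snd)).cons
    ((map ((hf.comp fst).append (fst.comp hm')) (snd.cons (const []))).append
      ((fst.comp (snd.comp hm')).append (polyTime_pairUp (snd.comp snd))))

theorem polyTime_candidates {C : α → ℕ} {l : α → List Item} (hC : PolyTime C) (hl : PolyTime l) :
    PolyTime fun a => candidates (C a) (l a) := by
  refine flatMap (g := fun a (q : List Item × List Item) => caseList q.2 []
    fun x r => candidatesAt (C a) x (q.1 ++ r)) (polyTime_splits hl) ?_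
  refine listCases (l := fun y : α × List Item × List Item => y.2.2)
    (g := fun y x r => candidatesAt (C y.1) x (y.2.1 ++ r)) (snd.comp snd) (const []) ?_
  exact polyTime_candidatesAt (hC.comp (fst.comp fst)) (fst.comp snd)
    ((fst.comp (snd.comp fst)).append (snd.comp snd))

theorem polyTime_excess {C : α → ℕ} {L : α → List (List Item)} (hC : PolyTime C)
    (hL : PolyTime L) : PolyTime fun a => excess (C a) (L a) :=
  sum (map (g := fun a b => weight b - C a) hL
    ((sum (map (g := fun _ (e : Item) => e.1) snd (fst.comp snd))).sub (hC.comp fst)))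

theorem polyTime_listCost {g : α → List ℕ} {L : α → List (List Item)} (hg : PolyTime g)
    (hL : PolyTime L) : PolyTime fun a => listCost (g a) (L a) := by
  have h : PolyTime fun y : α × List Item => y.2.foldr (fun _ c => c.tail) (g y.1) :=
    foldr' (step := fun _ _ c => c.tail) snd (hg.comp fst) (tail (snd.comp snd))
      ⟨0, fun a b c _ => by simpa using esize_sublist (List.tail_sublist c)⟩
  exact sum (map (g := fun a (b : List Item) => caseList (b.foldr (fun _ c => c.tail) (g a)) 0
    fun c _ => c) hL (listCases (g := fun _ c _ => c) h (const 0) (fst.comp snd)))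

theorem polyTime_best {C : α → ℕ} {g : α → List ℕ} {l : α → List Item} (hC : PolyTime C)
    (hg : PolyTime g) (hl : PolyTime l) : PolyTime fun a => best (C a) (g a) (l a) := by
  have hF : PolyTime fun a => (candidates (C a) (sortItems (C a) (l a))).filter
      fun L => decide (excess (C a) L = 0) :=
    filter (p := fun a L => excess (C a) L = 0) (polyTime_candidates hC (polyTime_sortItems hC hl))
      (polyTime_excess (hC.comp fst) snd).eqZero
  obtain ⟨P, hP⟩ := hF.esize_bound
  refine foldr' (step := fun a L M => if listCost (g a) L ≤ listCost (g a) M then L else M) hF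
    (map hl (snd.cons (const []))) ?_ ⟨P, fun a b c h => ?_⟩
  · exact PolyTime.ite (c := fun x : α × List (List Item) × List (List Item) =>
      listCost (g x.1) x.2.1 ≤ listCost (g x.1) x.2.2)
      ((polyTime_listCost (hg.comp fst) (fst.comp snd)).le
        (polyTime_listCost (hg.comp fst) (snd.comp snd))) (fst.comp snd) (snd.comp snd)
  · have h1 := hP a
    have h2 := esize_le_of_mem h
    split_ifs <;> omega

theorem polyTime_scale {l : α → List (ℕ × ℕ)} (hl : PolyTime l) :
    PolyTime fun a => scale (l a) := by
  have h : PolyTime fun a => ((l a).map fun q => q.2).prod := prod (map hl (snd.comp snd))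
  exact map hl ((fst.comp snd).mul ((h.comp fst).div (snd.comp snd)))

theorem polyTime_solve : PolyTime solve := by
  have h : PolyTime fun x : List (ℕ × ℕ) × List (ℕ × ℕ) => (x.1.map fun q => q.2).prod :=
    prod (map fst (snd.comp snd))
  exact map (polyTime_best h (polyTime_scale snd) (polyTime_zipIdx (polyTime_scale fst)))
    (map snd (snd.comp snd))

end PolyTime

end GCBP

/-! ### The greedy matching is optimal -/

namespace GCBP

section Matching

variable {C : ℕ}

theorem isBig_iff {e : Item} : isBig C e = true ↔ C < 2 * e.1 := by simp [isBig]

theorem isSmall_iff {e : Item} : isSmall C e = true ↔ 2 * e.1 ≤ C := by simp [isSmall]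

theorem isSmall_eq_not (e : Item) : isSmall C e = !isBig C e := by
  simp only [isSmall, isBig, decide_not]

theorem sortItems_perm (l : List Item) : (sortItems C l).Perm l := by
  induction l with
  | nil => exact List.Perm.nil
  | cons a l ih =>
    refine List.perm_middle.trans (List.Perm.cons a (List.Perm.trans ?_ ih))
    have := List.filter_append_perm (fun b => decide (key C a < key C b)) (sortItems C l)
    simp only [← decide_not] at this
    exact this

theorem pairwise_sortItems (l : List Item) :
    (sortItems C l).Pairwise fun a b => key C b ≤ key C a := by
  induction l with
  | nil => exact List.Pairwise.nil
  | cons a l ih =>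
    refine List.pairwise_append.2 ⟨ih.filter _, List.pairwise_cons.2 ⟨?_, ih.filter _⟩, ?_⟩
    · intro b hb
      simpa using (List.mem_filter.1 hb).2
    · intro b hb c hc
      have hb' : key C a < key C b := by simpa using (List.mem_filter.1 hb).2
      rcases List.mem_cons.1 hc with rfl | hc
      · exact hb'.le
      · have hc' : key C c ≤ key C a := by simpa using (List.mem_filter.1 hc).2
        omega

theorem key_of_small {e : Item} (h : 2 * e.1 ≤ C) : key C e = 2 * (C - e.1) + 1 := by
  rw [key, if_neg (by omega)]

theorem key_of_big {e : Item} (h : C < 2 * e.1) : key C e = 2 * e.1 := by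
  rw [key, if_pos h]

theorem greedy_cons (e : Item) (l : List Item) :
    greedy C (e :: l) = greedyStep C e (greedy C l) := rfl

theorem greedyStep_big {e : Item} (h : C < 2 * e.1)
    (c : List Item × List (List Item) × List Item) : greedyStep C e c = (e :: c.1, c.2) := by
  rw [greedyStep, if_pos h]

theorem greedyStep_nil {e : Item} (h : ¬ C < 2 * e.1) (c : List (List Item) × List Item) :
    greedyStep C e ([], c) = ([], c.1, e :: c.2) := by
  rw [greedyStep, if_neg h]; rfl

theorem greedyStep_cons {e : Item} (h : ¬ C < 2 * e.1) (z : Item) (t : List Item)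
    (c : List (List Item) × List Item) :
    greedyStep C e (z :: t, c) = (t, [e, z] :: c.1, c.2) := by
  rw [greedyStep, if_neg h]; rfl

theorem greedy_perm (l : List Item) :
    ((greedy C l).1 ++ ((greedy C l).2.1.flatten ++ (greedy C l).2.2)).Perm l := by
  induction l with
  | nil => exact List.Perm.nil
  | cons e l ih =>
    rw [greedy_cons]
    by_cases h : C < 2 * e.1
    · rw [greedyStep_big h]
      exact ih.cons e
    · generalize greedy C l = g at *
      obtain ⟨s, p, f⟩ := g
      cases s with
      | nil =>
        rw [greedyStep_nil h]
        exact List.perm_middle.trans (ih.cons e)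
      | cons z t =>
        rw [greedyStep_cons h]
        refine List.Perm.trans ?_ (ih.cons e)
        simp only [List.flatten_cons, List.cons_append, List.nil_append]
        exact List.perm_middle.trans (List.perm_middle.cons e)

theorem isBig_of_mem_greedy (l : List Item) : ∀ e ∈ (greedy C l).1, C < 2 * e.1 := by
  induction l with
  | nil => simp [greedy]
  | cons e l ih =>
    rw [greedy_cons]
    by_cases h : C < 2 * e.1
    · rw [greedyStep_big h]
      simpa [h] using ih
    · generalize greedy C l = g at *
      obtain ⟨s, p, f⟩ := g
      cases s with
      | nil => simp [greedyStep_nil h]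
      | cons z t =>
        rw [greedyStep_cons h]
        exact fun e he => ih e (List.mem_cons_of_mem z he)

theorem small_of_mem_greedy (l : List Item) : ∀ e ∈ (greedy C l).2.2, 2 * e.1 ≤ C := by
  induction l with
  | nil => simp [greedy]
  | cons e l ih =>
    rw [greedy_cons]
    by_cases h : C < 2 * e.1
    · rwa [greedyStep_big h]
    · generalize greedy C l = g at *
      obtain ⟨s, p, f⟩ := g
      cases s with
      | nil =>
        rw [greedyStep_nil h]
        intro e' he'
        rcases List.mem_cons.1 he' with rfl | he'
        · omega
        · exact ih e' he'
      | cons z t => rwa [greedyStep_cons h]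

/-- The free items keep the order of the list. In a sorted list small items have ascending sizes, so
a prefix of the free items consists of the smallest ones. -/
theorem greedy_free_sublist (l : List Item) : (greedy C l).2.2.Sublist l := by
  induction l with
  | nil => exact List.Sublist.refl _
  | cons e l ih =>
    rw [greedy_cons]
    by_cases h : C < 2 * e.1
    · rw [greedyStep_big h]
      exact ih.cons e
    · generalize greedy C l = g at *
      obtain ⟨s, p, f⟩ := g
      cases s with
      | nil => rw [greedyStep_nil h]; exact ih.cons_cons e
      | cons z t => rw [greedyStep_cons h]; exact ih.cons e

theorem length_of_mem_greedy (l : List Item) : ∀ b ∈ (greedy C l).2.1, b.length = 2 := by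
  induction l with
  | nil => simp [greedy]
  | cons e l ih =>
    rw [greedy_cons]
    by_cases h : C < 2 * e.1
    · rwa [greedyStep_big h]
    · generalize greedy C l = g at *
      obtain ⟨s, p, f⟩ := g
      cases s with
      | nil => rwa [greedyStep_nil h]
      | cons z t => rw [greedyStep_cons h]; simpa using ih

/-- A small item `e` is matched with a large item `z` that comes later in the list. The key
inequality reads `2 * z.1 ≤ 2 * (C - e.1) + 1`, and by parity this says that both fit together. -/
theorem weight_of_mem_greedy {l : List Item} (hl : l.Pairwise fun a b => key C b ≤ key C a) :
    ∀ b ∈ (greedy C l).2.1, weight b ≤ C := by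
  induction l with
  | nil => simp [greedy]
  | cons e l ih =>
    rw [List.pairwise_cons] at hl
    have ih := ih hl.2
    have hz := isBig_of_mem_greedy (C := C) l
    have hmem : ∀ z ∈ (greedy C l).1, z ∈ l :=
      fun z hz => (greedy_perm (C := C) l).subset (List.mem_append_left _ hz)
    rw [greedy_cons]
    by_cases h : C < 2 * e.1
    · rwa [greedyStep_big h]
    · generalize greedy C l = g at *
      obtain ⟨s, p, f⟩ := g
      cases s with
      | nil => rwa [greedyStep_nil h]
      | cons z t =>
        rw [greedyStep_cons h]
        intro b hb
        rcases List.mem_cons.1 hb with rfl | hb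
        · have h1 := hz z (by simp)
          have h2 := hl.1 z (hmem z (by simp))
          rw [key_of_big h1, key_of_small (by omega)] at h2
          simp only [weight, List.map_cons, List.map_nil, List.sum_cons, List.sum_nil]
          omega
        · exact ih b hb

theorem weight_cons (e : Item) (l : List Item) : weight (e :: l) = e.1 + weight l := by
  simp [weight]

theorem weight_perm {l m : List Item} (h : l.Perm m) : weight l = weight m :=
  (h.map _).sum_eq

theorem weight_take_le {Y F : List Item} (h : Y.Sublist F) (hF : F.Pairwise fun a b => a.1 ≤ b.1) :
    weight (F.take Y.length) ≤ weight Y := by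
  induction F generalizing Y with
  | nil => simp [List.sublist_nil.1 h]
  | cons e F ih =>
    rw [List.pairwise_cons] at hF
    cases Y with
    | nil => simp
    | cons y Y =>
      rw [List.length_cons, List.take_succ_cons, weight_cons, weight_cons]
      have h1 : Y.Sublist F := by
        cases h with
        | cons _ h => exact (List.sublist_cons_self _ _).trans h
        | cons_cons _ h => exact h
      have h2 : e.1 ≤ y.1 := by
        cases h with
        | cons _ h => exact hF.1 y (h.subset (by simp))
        | cons_cons _ h => exact le_rfl
      have := ih h1 hF.2
      omega

/-- If, in each prefix, all but `a` large items can be matched with small items that are not marked,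
then the greedy algorithm leaves at most `a` large items unmatched, and, up to such slack, its free
items include as many items as are marked, of at most the same total size. -/
theorem greedy_spec (m : Item → Bool) {l : List Item} (hm : ∀ e ∈ l, m e = true → 2 * e.1 ≤ C)
    (hl : l.Pairwise fun a b => 2 * a.1 ≤ C → 2 * b.1 ≤ C → a.1 ≤ b.1) (a : ℕ)
    (H : ∀ pre, pre <+: l →
      pre.countP (isBig C) ≤ a + pre.countP (fun e => isSmall C e && !m e)) (e₀ : ℕ)
    (h₀ : ∀ e ∈ l, 2 * e.1 ≤ C → e₀ ≤ e.1) :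
    ∃ (i : ℕ) (Y : List Item), i + (greedy C l).1.length ≤ a ∧ Y.Sublist (greedy C l).2.2 ∧
      i + Y.length = l.countP m ∧ i * e₀ + weight Y ≤ weight (l.filter m) := by
  -- Here `a` is the number of large items of `l` that items in front of `l` can still absorb. The
  -- number `i` counts marked items that the matching has consumed and that have not been replaced
  -- yet. Each is charged `e₀`, so that an item of size at most `e₀` in front of `l` can take its
  -- place.
  induction l generalizing a e₀ with
  | nil => exact ⟨0, [], by simp [greedy], List.Sublist.refl _, by simp, by simp [weight]⟩
  | cons e l ih =>
    rw [List.pairwise_cons] at hl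
    have hm' : ∀ e ∈ l, m e = true → 2 * e.1 ≤ C := fun x hx => hm x (List.mem_cons_of_mem _ hx)
    have h₀' : ∀ e ∈ l, 2 * e.1 ≤ C → e₀ ≤ e.1 := fun x hx => h₀ x (List.mem_cons_of_mem _ hx)
    have H' : ∀ pre, pre <+: l → (e :: pre).countP (isBig C) ≤
        a + (e :: pre).countP (fun e => isSmall C e && !m e) :=
      fun pre h => H _ ((List.prefix_cons_inj e).2 h)
    rw [greedy_cons]
    by_cases h : C < 2 * e.1
    · have hbig : isBig C e = true := isBig_iff.2 h
      have hme : m e = false := by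
        by_contra hc
        have := hm e (by simp) (by simpa using hc)
        omega
      simp only [List.countP_cons, isSmall_eq_not, hbig] at H'
      -- The prefix `[e]` contains one large item and no small one, so there is slack for `e`.
      obtain ⟨b, rfl⟩ : ∃ b, a = b + 1 := by
        have := H' [] (List.nil_prefix)
        simp at this
        exact ⟨a - 1, by omega⟩
      obtain ⟨i, Y, h1, h2, h3, h4⟩ := ih hm' hl.2 b (fun pre hp => by
        have := H' pre hp
        simp only [isSmall_eq_not]
        simp at this ⊢
        omega) e₀ h₀'
      rw [greedyStep_big h]
      refine ⟨i, Y, ?_, h2, ?_, ?_⟩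
      · simp only [List.length_cons]; omega
      · rw [List.countP_cons_of_neg (by simp [hme])]; exact h3
      · rw [List.filter_cons_of_neg (by simp [hme])]; exact h4
    · have hbig : isBig C e = false := by simp [isBig]; omega
      have he₀ : e₀ ≤ e.1 := h₀ e (by simp) (by omega)
      simp only [List.countP_cons, isSmall_eq_not, hbig] at H'
      by_cases hme : m e = true
      · obtain ⟨i, Y, h1, h2, h3, h4⟩ := ih hm' hl.2 a (fun pre hp => by
          have := H' pre hp
          simp only [isSmall_eq_not]
          simpa [hme] using this) e₀ h₀'
        rw [List.countP_cons_of_pos hme, List.filter_cons_of_pos hme, weight_cons]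
        generalize greedy C l = g at *
        obtain ⟨s, p, f⟩ := g
        cases s with
        | nil =>
          rw [greedyStep_nil h]
          refine ⟨i, e :: Y, h1, h2.cons_cons e, ?_, ?_⟩
          · rw [List.length_cons]; omega
          · rw [weight_cons]; omega
        | cons z t =>
          rw [greedyStep_cons h]
          -- The matching consumes the marked item `e`. The loss is recorded in `i`, charged `e₀ ≤
          -- e.1`, and one large item fewer is unmatched.
          refine ⟨i + 1, Y, ?_, h2, by omega, ?_⟩
          · simp only [List.length_cons] at h1 ⊢; omega
          · rw [Nat.succ_mul]; omega
      · have hme : m e = false := by simpa using hme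
        have H'' : ∀ pre, pre <+: l → pre.countP (isBig C) ≤
            (a + 1) + pre.countP (fun e => isSmall C e && !m e) := fun pre hp => by
          have := H' pre hp
          simp only [isSmall_eq_not]
          simp [hme] at this ⊢
          omega
        rw [List.countP_cons_of_neg (by simp [hme]), List.filter_cons_of_neg (by simp [hme])]
        -- An unmarked small item gives one more unit of slack. Missing items of the tail are
        -- charged the size of `e`, which is at most every small size there, so `e` can replace one
        -- of them.
        obtain ⟨i, Y, h1, h2, h3, h4⟩ := ih hm' hl.2 (a + 1) H'' e.1
          (fun x hx hx' => hl.1 x hx (by omega) hx')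
        have hi : i * e₀ ≤ i * e.1 := Nat.mul_le_mul_left _ he₀
        generalize greedy C l = g at *
        obtain ⟨s, p, f⟩ := g
        cases s with
        | nil =>
          rw [greedyStep_nil h]
          cases i with
          | zero => exact ⟨0, Y, by simp, h2.cons e, h3, by simpa using h4⟩
          | succ i =>
            -- Since `e` stays free, it fills one missing place at exactly the price charged for it.
            refine ⟨i, e :: Y, ?_, h2.cons_cons e, ?_, ?_⟩
            · simp only [List.length_nil] at h1 ⊢; omega
            · rw [List.length_cons]; omega
            · rw [Nat.succ_mul] at hi h4
              rw [weight_cons]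
              have : i * e₀ ≤ i * e.1 := Nat.mul_le_mul_left _ he₀
              omega
        | cons z t =>
          rw [greedyStep_cons h]
          refine ⟨i, Y, ?_, h2, h3, by omega⟩
          simp only [List.length_cons] at h1 ⊢; omega

end Matching

/-! ### Splitting a list into pairs, and costs of lists of bins. -/

section PairUp

theorem pairUp_fold (l : List Item) :
    ((l.foldr pairStep ([], [])).1 ++ (l.foldr pairStep ([], [])).2.flatten).Perm l ∧
    (l.foldr pairStep ([], [])).1.length = l.length % 2 ∧
    (l.foldr pairStep ([], [])).2.length = l.length / 2 ∧
    ∀ b ∈ (l.foldr pairStep ([], [])).2, b.length = 2 := by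
  induction l with
  | nil => simp
  | cons e l ih =>
    rw [List.foldr_cons]
    generalize l.foldr pairStep ([], []) = g at *
    obtain ⟨s, p⟩ := g
    obtain ⟨h1, h2, h3, h4⟩ := ih
    rcases s with _ | ⟨z, _ | ⟨z', t⟩⟩
    · refine ⟨h1.cons e, ?_, ?_, h4⟩
      all_goals
        simp only [pairStep, BitCost.caseList, List.length_cons, List.length_nil] at *
        omega
    · refine ⟨h1.cons e, ?_, ?_, ?_⟩
      · simp only [pairStep, BitCost.caseList, List.length_cons, List.length_nil] at *
        omega
      · simp only [pairStep, BitCost.caseList, List.length_cons, List.length_nil] at *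
        omega
      · simpa [pairStep, BitCost.caseList] using h4
    · simp only [List.length_cons] at h2
      omega

theorem pairUp_perm (l : List Item) : (pairUp l).flatten.Perm l := by
  refine List.Perm.trans ?_ (pairUp_fold l).1
  rw [pairUp, List.flatten_append]
  refine List.perm_append_comm.trans (List.Perm.append_right _ ?_)
  rw [← List.flatMap_def, List.flatMap_singleton']

/-- The cost of a list of bins. -/
def binCost {α : Type} (f : ℕ → ℚ) (L : List (List α)) : ℚ := (L.map fun b => f b.length).sum

section binCost

variable {α : Type} (f : ℕ → ℚ)

theorem binCost_append (L M : List (List α)) : binCost f (L ++ M) = binCost f L + binCost f M := by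
  simp [binCost]

theorem binCost_cons (b : List α) (L : List (List α)) :
    binCost f (b :: L) = f b.length + binCost f L := by
  simp [binCost]

theorem binCost_const {L : List (List α)} {k : ℕ} (h : ∀ b ∈ L, b.length = k) :
    binCost f L = L.length * f k := by
  induction L with
  | nil => simp [binCost]
  | cons b L ih =>
    rw [binCost_cons, ih fun c hc => h c (by simp [hc]), h b (by simp), List.length_cons]
    push_cast
    ring

end binCost

theorem binCost_pairUp (f : ℕ → ℚ) (l : List Item) :
    binCost f (pairUp l) = (l.length / 2 : ℕ) * f 2 + (l.length % 2 : ℕ) * f 1 := by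
  obtain ⟨-, h2, h3, h4⟩ := pairUp_fold l
  rw [pairUp, binCost_append, binCost_const f h4, h3,
    binCost_const f (k := 1) (fun b hb => by obtain ⟨a, -, rfl⟩ := List.mem_map.1 hb; rfl), List.length_map, h2]

theorem length_of_mem_pairUp {l : List Item} {b : List Item} (h : b ∈ pairUp l) :
    b.length = 1 ∨ b.length = 2 := by
  rcases List.mem_append.1 h with h | h
  · exact .inr ((pairUp_fold l).2.2.2 b h)
  · obtain ⟨a, -, rfl⟩ := List.mem_map.1 h
    exact .inl rfl

theorem weight_of_mem_pairUp {C : ℕ} {l : List Item} (hl : ∀ e ∈ l, 2 * e.1 ≤ C) {b : List Item}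
    (h : b ∈ pairUp l) : weight b ≤ C := by
  have hb : ∀ e ∈ b, 2 * e.1 ≤ C := fun e he =>
    hl e ((pairUp_perm l).subset (List.mem_flatten.2 ⟨b, h, he⟩))
  rcases length_of_mem_pairUp h with h | h
  · obtain ⟨x, rfl⟩ := List.length_eq_one_iff.1 h
    have := hb x (by simp)
    simp [weight]; omega
  · obtain ⟨x, y, rfl⟩ := List.length_eq_two.1 h
    have := hb x (by simp)
    have := hb y (by simp)
    simp [weight]; omega

end PairUp

end GCBP

/-! ### The candidates contain an optimal packing -/

namespace GCBP

section Candidates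

variable {C : ℕ}

theorem excess_eq_zero {L : List (List Item)} : excess C L = 0 ↔ ∀ b ∈ L, weight b ≤ C := by
  simp [excess, List.sum_eq_zero_iff, Nat.sub_eq_zero_iff_le]

theorem flatten_map_singleton {α : Type} (l : List α) : (l.map fun a => [a]).flatten = l := by
  rw [← List.flatMap_def, List.flatMap_singleton']

theorem matchItems_perm (q' : List Item × List Item) :
    (q'.1.filter (isBig C) ++ matchItems C q').Perm (q'.1 ++ q'.2) := by
  rw [matchItems, ← List.append_assoc]
  refine List.Perm.append_right _ ?_
  have := List.filter_append_perm (isBig C) q'.1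
  simpa only [← isSmall_eq_not] using this

theorem packingOf_spec {x : Item} {q' q'' : List Item × List Item}
    (h : q'' ∈ splits (greedy C (matchItems C q')).2.2) :
    (packingOf C x q' (greedy C (matchItems C q')) q'').flatten.Perm (x :: (q'.1 ++ q'.2)) ∧
      [] ∉ packingOf C x q' (greedy C (matchItems C q')) q'' := by
  constructor
  · refine List.Perm.trans ?_ ((matchItems_perm (C := C) q').cons x)
    have h1 := greedy_perm (C := C) (matchItems C q')
    have h2 := mem_splits.1 h
    have h3 := pairUp_perm q''.2
    generalize greedy C (matchItems C q') = g at *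
    rw [packingOf, List.flatten_cons, List.cons_append, List.flatten_append,
      flatten_map_singleton, List.flatten_append]
    refine List.Perm.cons x (List.perm_iff_count.2 fun a => ?_)
    have h1 := h1.count_eq a
    have h2 := congrArg (List.count a) h2
    have h3 := h3.count_eq a
    simp only [List.count_append] at *
    omega
  · intro hn
    rcases List.mem_cons.1 hn with hn | hn
    · exact absurd hn (by simp)
    · rcases List.mem_append.1 hn with hn | hn
      · obtain ⟨a, -, ha⟩ := List.mem_map.1 hn
        exact absurd ha (by simp)
      · rcases List.mem_append.1 hn with hn | hn
        · exact absurd (length_of_mem_greedy _ _ hn) (by simp)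
        · exact absurd (length_of_mem_pairUp hn) (by simp)

theorem candidates_spec {l : List Item} {L : List (List Item)} (h : L ∈ candidates C l) :
    L.flatten.Perm l ∧ [] ∉ L := by
  obtain ⟨⟨p, s⟩, hq, hL⟩ := List.mem_flatMap.1 h
  cases s with
  | nil => cases hL
  | cons x r =>
    obtain ⟨q', hq', hL⟩ := List.mem_flatMap.1 hL
    obtain ⟨q'', hq'', rfl⟩ := List.mem_map.1 hL
    have h1 := packingOf_spec (x := x) hq''
    rw [mem_splits.1 hq'] at h1
    refine ⟨h1.1.trans ?_, h1.2⟩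
    rw [← mem_splits.1 hq]
    exact List.perm_middle.symm

theorem exists_perm_cons_max {B : List Item} (hB : B ≠ []) :
    ∃ x B', B.Perm (x :: B') ∧ ∀ b ∈ B', b.1 ≤ x.1 := by
  induction B with
  | nil => exact absurd rfl hB
  | cons a B ih =>
    rcases eq_or_ne B [] with rfl | hB
    · exact ⟨a, [], List.Perm.refl _, by simp⟩
    · obtain ⟨x, B', h1, h2⟩ := ih hB
      rcases le_total a.1 x.1 with h | h
      · exact ⟨x, a :: B', (h1.cons a).trans (List.Perm.swap x a B'), by simpa [h] using h2⟩
      · refine ⟨a, x :: B', h1.cons a, ?_⟩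
        intro b hb
        rcases List.mem_cons.1 hb with rfl | hb
        · exact h
        · exact (h2 b hb).trans h

/-- Lengthening a prefix by one entry raises the count by at most one, so no intermediate value is
skipped. This yields the prefix with the large items to be packed alone. -/
theorem exists_append_countP {α : Type} (p : α → Bool) {l : List α} {u : ℕ} (h : u ≤ l.countP p) :
    ∃ pre suf, l = pre ++ suf ∧ pre.countP p = u := by
  induction l generalizing u with
  | nil => exact ⟨[], [], rfl, by simpa [eq_comm] using h⟩
  | cons a l ih =>
    rcases Nat.eq_zero_or_pos u with rfl | hu
    · exact ⟨[], a :: l, rfl, rfl⟩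
    · by_cases ha : p a = true
      · rw [List.countP_cons_of_pos ha] at h
        obtain ⟨pre, suf, rfl, h⟩ := ih (u := u - 1) (by omega)
        exact ⟨a :: pre, suf, rfl, by rw [List.countP_cons_of_pos ha]; omega⟩
      · rw [List.countP_cons_of_neg ha] at h
        obtain ⟨pre, suf, rfl, h⟩ := ih h
        exact ⟨a :: pre, suf, rfl, by rw [List.countP_cons_of_neg ha]; omega⟩

/-- The number of bins that consist of one large item. -/
def bigSingles (C : ℕ) (L : List (List Item)) : ℕ :=
  L.countP fun b => decide (b.length = 1) && b.all (isBig C)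

theorem bigSingles_le (L : List (List Item)) : bigSingles C L ≤ L.flatten.countP (isBig C) := by
  induction L with
  | nil => exact le_rfl
  | cons b L ih =>
    rw [bigSingles, List.countP_cons, List.flatten_cons, List.countP_append]
    split_ifs with h
    · simp only [Bool.and_eq_true, decide_eq_true_eq] at h
      obtain ⟨x, rfl⟩ := List.length_eq_one_iff.1 h.1
      have hx : isBig C x = true := by simpa using h.2
      rw [List.countP_singleton, if_pos hx]
      unfold bigSingles at ih
      omega
    · unfold bigSingles at ih
      omega

/-- A large item selected by `d` is either alone or shares its bin with one other item. That item is
small, since two large items do not fit together, and it is selected as well by `hd`. -/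
theorem countP_big_le {L : List (List Item)} (hw : ∀ b ∈ L, weight b ≤ C)
    (hlen : ∀ b ∈ L, b.length = 1 ∨ b.length = 2) (d : Item → Bool)
    (hd : ∀ y ∈ L.flatten, ∀ z ∈ L.flatten, 2 * y.1 ≤ C → C < 2 * z.1 → y.1 + z.1 ≤ C →
      d z = true → d y = true) :
    L.flatten.countP (fun e => isBig C e && d e) ≤
      bigSingles C L + L.flatten.countP (fun e => isSmall C e && d e) := by
  induction L with
  | nil => simp
  | cons b L ih =>
    have ih := ih (fun c hc => hw c (by simp [hc])) (fun c hc => hlen c (by simp [hc]))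
      (fun y hy z hz => hd y (by simp only [List.flatten_cons, List.mem_append]; exact .inr hy) z
        (by simp only [List.flatten_cons, List.mem_append]; exact .inr hz))
    have hb := hw b (by simp)
    unfold bigSingles at *
    rw [List.countP_cons, List.flatten_cons, List.countP_append, List.countP_append]
    generalize L.flatten.countP (fun e => isBig C e && d e) = k₁ at *
    generalize L.flatten.countP (fun e => isSmall C e && d e) = k₂ at *
    generalize L.countP (fun b => decide (b.length = 1) && b.all (isBig C)) = k₃ at *
    rcases hlen b (by simp) with h | h
    · obtain ⟨x, rfl⟩ := List.length_eq_one_iff.1 h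
      simp only [List.countP_singleton, isSmall_eq_not]
      cases hx : isBig C x <;> cases hdx : d x <;> simp [hx] <;> omega
    · obtain ⟨x, y, rfl⟩ := List.length_eq_two.1 h
      have hxy : x.1 + y.1 ≤ C := by simpa [weight] using hb
      have h1 := fun a b => hd x (by simp) y (by simp) a b hxy
      have h2 := fun a b => hd y (by simp) x (by simp) a b (Nat.add_comm x.1 y.1 ▸ hxy)
      rw [← isSmall_iff, ← isBig_iff, isSmall_eq_not] at h1 h2
      have h3 : ¬ (isBig C x = true ∧ isBig C y = true) := by
        rw [isBig_iff, isBig_iff]; omega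
      clear hd hlen hw hb hxy
      simp only [List.countP_cons, List.countP_nil, isSmall_eq_not]
      generalize isBig C x = bx at *
      generalize isBig C y = bz at *
      generalize d x = dx at *
      generalize d y = dy at *
      cases bx <;> cases bz <;> cases dx <;> cases dy <;> simp at h1 h2 h3 ⊢ <;> omega

/-- Counting in a prefix becomes counting in the whole list with a membership test, which is
invariant under permutation and can thus be evaluated bin by bin. Distinctness of the items is
needed here. -/
theorem countP_prefix {p d : Item → Bool} {pre suf : List Item} (h : (pre ++ suf).Nodup)
    (hd : ∀ e, d e = decide (e ∈ pre)) :
    (pre ++ suf).countP (fun e => p e && d e) = pre.countP p := by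
  have hdis := (List.nodup_append'.1 h).2.2
  rw [List.countP_append]
  have h1 : suf.countP (fun e => p e && d e) = 0 := by
    rw [List.countP_eq_zero]
    intro e he
    have : e ∉ pre := fun h' => hdis h' he
    simp [hd, this]
  have h2 : pre.countP (fun e => p e && d e) = pre.countP p := by
    refine List.countP_congr fun e he => ?_
    simp [hd, he]
  omega

/-- In each prefix of the sorted list of the items other than the largest item of the special bin,
all large items but those that are packed alone are matched with small items. -/
theorem prefix_condition {R B : List Item} {rest : List (List Item)} (hnd : R.Nodup)
    (hs : R.Pairwise fun a b => key C b ≤ key C a) (hp : (B ++ rest.flatten).Perm R)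
    (hB : ∀ e ∈ B, 2 * e.1 ≤ C) (hw : ∀ b ∈ rest, weight b ≤ C)
    (hlen : ∀ b ∈ rest, b.length = 1 ∨ b.length = 2) (pre : List Item) (hpre : pre <+: R) :
    pre.countP (isBig C) ≤
      bigSingles C rest + pre.countP (fun e => isSmall C e && !decide (e ∈ B)) := by
  obtain ⟨suf, rfl⟩ := hpre
  set d : Item → Bool := fun e => decide (e ∈ pre) with hd
  have hd' : ∀ e, d e = decide (e ∈ pre) := fun e => rfl
  rw [← countP_prefix hnd hd', ← countP_prefix (p := fun e => isSmall C e && !decide (e ∈ B)) hnd hd',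
    ← hp.countP_eq, ← hp.countP_eq, List.countP_append, List.countP_append]
  have h0 : B.countP (fun e => isBig C e && d e) = 0 := by
    rw [List.countP_eq_zero]
    intro e he
    have : isBig C e = false := by
      have := hB e he
      simp [isBig]; omega
    simp [this]
  have h1 := countP_big_le hw hlen d (fun y hy z hz hy2 hz2 hyz hdz => by
    have hy' : y ∈ pre ++ suf := hp.subset (List.mem_append_right _ hy)
    rw [hd', decide_eq_true_eq] at hdz ⊢
    rcases List.mem_append.1 hy' with h | h
    · exact h
    -- If the partner `y` came after the large item `z`, the sorting would give `key C y ≤ key C z`,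
    -- which contradicts that both fit into one bin.
    · have := (List.pairwise_append.1 hs).2.2 z hdz y h
      rw [key_of_small hy2, key_of_big hz2] at this
      omega)
  have hdis := (List.nodup_append'.1 (hp.nodup_iff.2 hnd)).2.2
  have h2 : rest.flatten.countP (fun e => isSmall C e && d e) =
      rest.flatten.countP (fun e => isSmall C e && !decide (e ∈ B) && d e) := by
    refine List.countP_congr fun e he => ?_
    have : e ∉ B := fun h => hdis h he
    simp [this]
  omega

/-- The cost depends only on the numbers `s` of singletons and `p` of pairs; `bigSingles C L ≤ s`
since small items may be packed alone too. -/
theorem binCost_rest (f : ℕ → ℚ) {L : List (List Item)}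
    (hlen : ∀ b ∈ L, b.length = 1 ∨ b.length = 2) :
    ∃ s p : ℕ, binCost f L = s * f 1 + p * f 2 ∧ L.flatten.length = s + 2 * p ∧
      bigSingles C L ≤ s := by
  induction L with
  | nil => exact ⟨0, 0, by simp [binCost], rfl, le_rfl⟩
  | cons b L ih =>
    obtain ⟨s, p, h1, h2, h3⟩ := ih fun c hc => hlen c (by simp [hc])
    unfold bigSingles at *
    rw [binCost_cons, h1, List.flatten_cons, List.length_append, h2, List.countP_cons]
    rcases hlen b (by simp) with h | h
    · refine ⟨s + 1, p, ?_, by omega, ?_⟩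
      · rw [h]; push_cast; ring
      · split_ifs <;> omega
    · refine ⟨s, p + 1, ?_, by omega, ?_⟩
      · rw [h]; push_cast; ring
      · simpa [h] using h3

/-- The candidate packs as many large items alone as `rest` does, but the first ones in the sorted
order. The greedy matching then covers all other large items, and the smallest free items replace
`B`. -/
theorem exists_candidateAt {R B : List Item} {rest : List (List Item)} {x : Item} (hnd : R.Nodup)
    (hs : R.Pairwise fun a b => key C b ≤ key C a) (hp : (B ++ rest.flatten).Perm R)
    (hB : ∀ e ∈ B, 2 * e.1 ≤ C) (hxB : weight (x :: B) ≤ C) (hw : ∀ b ∈ rest, weight b ≤ C)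
    (hlen : ∀ b ∈ rest, b.length = 1 ∨ b.length = 2) (f : ℕ → ℚ) (hf : f 2 ≤ 2 * f 1) :
    ∃ L ∈ candidatesAt C x R, excess C L = 0 ∧ binCost f L ≤ binCost f ((x :: B) :: rest) := by
  have hu : bigSingles C rest ≤ R.countP (isBig C) := by
    rw [← hp.countP_eq, List.countP_append]
    have := bigSingles_le (C := C) rest
    omega
  have hRC : ∀ e ∈ R, e.1 ≤ C := by
    intro e he
    rcases List.mem_append.1 (hp.symm.subset he) with h | h
    · have := hB e h; omega
    · obtain ⟨b, hb, heb⟩ := List.mem_flatten.1 h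
      exact (List.single_le_sum (by simp) _ (List.mem_map_of_mem heb)).trans (hw b hb)
  obtain ⟨pre, suf, rfl, hpre⟩ := exists_append_countP _ hu
  have hsub : (matchItems C (pre, suf)).Sublist (pre ++ suf) :=
    List.filter_sublist.append (List.Sublist.refl _)
  have hsort := hs.sublist hsub
  have hsmall : ∀ l : List Item, (l.Pairwise fun a b => key C b ≤ key C a) →
      l.Pairwise fun a b => 2 * a.1 ≤ C → 2 * b.1 ≤ C → a.1 ≤ b.1 := fun l hl =>
    hl.imp fun {a b} h ha hb => by
      rw [key_of_small ha, key_of_small hb] at h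
      omega
  have hmarked : ((matchItems C (pre, suf)).filter fun e => decide (e ∈ B)).Perm B := by
    have hBnd := (List.nodup_append'.1 (hp.nodup_iff.2 hnd)).1
    refine (List.perm_ext_iff_of_nodup ((hnd.sublist hsub).filter _) hBnd).2 fun e => ?_
    simp only [List.mem_filter, decide_eq_true_eq, and_iff_right_iff_imp]
    intro he
    rcases List.mem_append.1 (hp.subset (List.mem_append_left _ he)) with h | h
    · exact List.mem_append_left _ (List.mem_filter.2 ⟨h, isSmall_iff.2 (hB e he)⟩)
    · exact List.mem_append_right _ h
  -- With the items of `B` marked and slack `0`, the conclusion leaves no large item unmatched and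
  -- no marked item unreplaced; the charge `0` then plays no role.
  obtain ⟨i, Y, h1, h2, h3, h4⟩ := greedy_spec (C := C) (fun e => decide (e ∈ B))
    (l := matchItems C (pre, suf)) (fun e _ he => hB e (by simpa using he)) (hsmall _ hsort) 0
    (fun p hpp => by
      have hsm : (pre.filter (isSmall C)).countP (isBig C) = 0 := by
        rw [List.countP_eq_zero]
        intro e he
        have := isSmall_iff.1 (List.mem_filter.1 he).2
        rw [isBig_iff]
        omega
      -- A prefix within the small items of `pre` has no large items. A longer one comes from a
      -- prefix `pre ++ t` of the sorted list, where the large items of `pre` cancel against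
      -- `bigSingles C rest`.
      rcases List.prefix_or_prefix_of_prefix hpp (List.prefix_append _ _) with h | ⟨t, rfl⟩
      · have : p.countP (isBig C) ≤ (pre.filter (isSmall C)).countP (isBig C) := h.sublist.countP_le
        omega
      · have ht : pre ++ t <+: pre ++ suf :=
          (List.prefix_append_right_inj _).2 ((List.prefix_append_right_inj _).1 hpp)
        have h := prefix_condition hnd hs hp hB hw hlen _ ht
        have hfil : (pre.filter (isSmall C)).countP (fun e => isSmall C e && !decide (e ∈ B)) =
            pre.countP (fun e => isSmall C e && !decide (e ∈ B)) := by
          rw [List.countP_filter]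
          refine List.countP_congr fun e _ => ?_
          cases isSmall C e <;> simp
        rw [List.countP_append, List.countP_append, hpre] at h
        rw [List.countP_append, List.countP_append, hsm, hfil]
        omega)
    0 (fun _ _ _ => Nat.zero_le _)
  rw [List.countP_eq_length_filter, hmarked.length_eq] at h3
  rw [weight_perm hmarked] at h4
  have hst : (greedy C (matchItems C (pre, suf))).1 = [] := List.length_eq_zero_iff.1 (by omega)
  have hY : Y.length = B.length := by omega
  set g := greedy C (matchItems C (pre, suf)) with hg
  have hle := weight_take_le h2 ((hsmall _ (hsort.sublist (greedy_free_sublist _))).imp_of_mem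
    fun {a b} ha hb h => h (small_of_mem_greedy _ a ha) (small_of_mem_greedy _ b hb))
  have hYF := h2.length_le
  refine ⟨packingOf C x (pre, suf) g (g.2.2.take B.length, g.2.2.drop B.length),
    List.mem_flatMap.2 ⟨(pre, suf), mem_splits.2 rfl, List.mem_map.2
      ⟨_, mem_splits.2 (List.take_append_drop _ _), rfl⟩⟩, excess_eq_zero.2 ?_, ?_⟩
  · intro b hb
    rw [packingOf, hst, List.append_nil] at hb
    rcases List.mem_cons.1 hb with rfl | hb
    · rw [weight_cons] at hxB ⊢
      rw [hY] at hle
      dsimp only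
      omega
    · rcases List.mem_append.1 hb with hb | hb
      · obtain ⟨e, he, rfl⟩ := List.mem_map.1 hb
        have := hRC e (List.mem_append_left _ (List.mem_filter.1 he).1)
        simpa [weight] using this
      · rcases List.mem_append.1 hb with hb | hb
        · exact weight_of_mem_greedy hsort b hb
        · exact weight_of_mem_pairUp
            (fun e he => small_of_mem_greedy _ e (List.mem_of_mem_drop he)) hb
  · obtain ⟨s, p, hc1, hc2, hc3⟩ := binCost_rest (C := C) f hlen
    have hlenR := hp.length_eq
    have hlenM := (matchItems_perm (C := C) (pre, suf)).length_eq
    have hlenG := (greedy_perm (C := C) (matchItems C (pre, suf))).length_eq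
    have hflat : g.2.1.flatten.length = 2 * g.2.1.length := by
      rw [List.length_flatten, hg, List.map_congr_left (g := fun _ => 2)
        (fun b hb => length_of_mem_greedy _ b hb)]
      simp [mul_comm]
    rw [← hg, hst] at hlenG
    simp only [List.length_append, List.length_nil, ← List.countP_eq_length_filter, hpre]
      at hlenR hlenM hlenG
    rw [packingOf, hst, List.append_nil, binCost_cons, binCost_cons, binCost_append, binCost_append,
      binCost_pairUp, hc1, binCost_const f (k := 1) (L := (pre.filter (isBig C)).map fun a => [a])
        (fun b hb => by obtain ⟨a, -, rfl⟩ := List.mem_map.1 hb; rfl),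
      binCost_const f (length_of_mem_greedy _), List.length_map, ← List.countP_eq_length_filter,
      hpre, List.length_cons, List.length_cons, List.length_take, min_eq_left (by omega),
      List.length_drop]
    -- Both packings place the same number of items outside the special bin. The candidate has `k`
    -- more pairs and `2 * k` fewer singletons, which is no loss because `f 2 ≤ 2 * f 1`.
    obtain ⟨k, hk1, hk2⟩ : ∃ k, s = bigSingles C rest + (g.2.2.length - B.length) % 2 + 2 * k ∧
        g.2.1.length + (g.2.2.length - B.length) / 2 = p + k := by
      refine ⟨g.2.1.length + (g.2.2.length - B.length) / 2 - p, ?_, ?_⟩ <;> omega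
    have hk2' : (g.2.1.length : ℚ) + ((g.2.2.length - B.length) / 2 : ℕ) = p + k := by
      exact_mod_cast hk2
    have hk0 : (0 : ℚ) ≤ k := Nat.cast_nonneg k
    rw [hk1]
    push_cast at hk2' ⊢
    nlinarith [mul_le_mul_of_nonneg_left hf hk0, congrArg (· * f 2) hk2']

theorem exists_candidate {l B : List Item} {rest : List (List Item)} (hnd : l.Nodup)
    (hs : l.Pairwise fun a b => key C b ≤ key C a) (hp : (B :: rest).flatten.Perm l) (hB : B ≠ [])
    (hw : ∀ b ∈ B :: rest, weight b ≤ C) (hlen : ∀ b ∈ rest, b.length = 1 ∨ b.length = 2)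
    (f : ℕ → ℚ) (hf : f 2 ≤ 2 * f 1) :
    ∃ L ∈ candidates C l, excess C L = 0 ∧ binCost f L ≤ binCost f (B :: rest) := by
  obtain ⟨x, B', hxB, hmax⟩ := exists_perm_cons_max hB
  have hp' : (x :: (B' ++ rest.flatten)).Perm l := (hxB.symm.append_right _).trans hp
  obtain ⟨p, q, rfl⟩ := List.append_of_mem (hp'.subset (List.mem_cons_self))
  have hsub : (p ++ q).Sublist (p ++ x :: q) :=
    (List.Sublist.refl p).append (List.sublist_cons_self x q)
  have hwB : weight (x :: B') ≤ C := weight_perm hxB ▸ hw B (by simp)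
  obtain ⟨L, hL, h1, h2⟩ := exists_candidateAt (x := x) (hnd.sublist hsub) (hs.sublist hsub)
    ((hp'.trans List.perm_middle).cons_inv)
    -- Since `e` is at most `x` and fits together with `x`, it is at most half the capacity.
    (fun e he => by
      have h1 := hmax e he
      have h2 : e.1 ≤ weight B' := List.single_le_sum (by simp) _ (List.mem_map_of_mem he)
      rw [weight_cons] at hwB
      omega) hwB (fun b hb => hw b (by simp [hb])) hlen f hf
  refine ⟨L, List.mem_flatMap.2 ⟨(p, x :: q), mem_splits.2 rfl, hL⟩, h1, ?_⟩
  rwa [binCost_cons, ← hxB.length_eq, ← binCost_cons] at h2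

end Candidates

end GCBP

/-! ### Optimal packings of a special form -/

namespace GCBP

open BitCost

section SpecialForm

variable {C : ℕ}

theorem weight_append (l m : List Item) : weight (l ++ m) = weight l + weight m := by
  simp [weight]

theorem weight_le_of_mem {L : List (List Item)} {b : List Item} (hb : b ∈ L) :
    weight b ≤ weight L.flatten := by
  induction L with
  | nil => cases hb
  | cons c L ih =>
    rw [List.flatten_cons, weight_append]
    rcases List.mem_cons.1 hb with rfl | hb
    · omega
    · have := ih hb; omega

theorem weight_le_of_mem_pairUp_of_weight_le {l b : List Item} (hl : weight l ≤ C)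
    (hb : b ∈ pairUp l) : weight b ≤ C :=
  (weight_le_of_mem hb).trans ((weight_perm (pairUp_perm l)).le.trans hl)

/-- The smaller of the first two items is at most half of their sum. -/
theorem exists_perm_cons_small {b : List Item} (hb : 2 ≤ b.length) (hw : weight b ≤ C) :
    ∃ e r, b.Perm (e :: r) ∧ 2 * e.1 ≤ C := by
  rcases b with _ | ⟨x, _ | ⟨y, t⟩⟩
  · simp at hb
  · simp at hb
  · rw [weight_cons, weight_cons] at hw
    rcases le_total x.1 y.1 with h | h
    · exact ⟨x, y :: t, List.Perm.refl _, by omega⟩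
    · exact ⟨y, x :: t, List.Perm.swap y x t, by omega⟩

/-- If pairs are the most efficient bins, then every packing can be changed into one that is not
more expensive, in which at most one bin has more than two items, and an odd number of them. -/
theorem exists_special_form (f : ℕ → ℚ) {N : ℕ}
    (hf : ∀ j, 1 ≤ j → j ≤ N → (j : ℚ) * f 2 ≤ 2 * f j) {L : List (List Item)} (hne : [] ∉ L)
    (hN : L.flatten.length ≤ N) (hw : ∀ b ∈ L, weight b ≤ C) :
    ∃ big small : List (List Item), (big ++ small).flatten.Perm L.flatten ∧ big.length ≤ 1 ∧
      (∀ b ∈ big, 3 ≤ b.length ∧ Odd b.length) ∧ (∀ b ∈ small, b.length = 1 ∨ b.length = 2) ∧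
      (∀ b ∈ big ++ small, weight b ≤ C) ∧ binCost f (big ++ small) ≤ binCost f L := by
  induction L with
  | nil => exact ⟨[], [], List.Perm.nil, by simp, by simp, by simp, by simp, le_rfl⟩
  | cons b L ih =>
    rw [List.flatten_cons, List.length_append] at hN
    obtain ⟨big, small, hp, hbl, hb3, hs, hw', hc⟩ := ih (fun h => hne (by simp [h])) (by omega)
      (fun c hc => hw c (by simp [hc]))
    have hb0 : b.length ≠ 0 := fun h => hne (by simp [List.length_eq_zero_iff.1 h])
    have hwb := hw b (by simp)
    rw [List.flatten_cons, binCost_cons]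
    by_cases h12 : b.length = 1 ∨ b.length = 2
    · refine ⟨big, b :: small, ?_, hbl, hb3, by simpa [h12] using hs, ?_, ?_⟩
      · refine List.Perm.trans ?_ (hp.append_left b)
        rw [List.flatten_append, List.flatten_append, List.flatten_cons, ← List.append_assoc,
          ← List.append_assoc]
        exact List.perm_append_comm.append_right _
      · intro c hc
        rw [List.mem_append, List.mem_cons, or_left_comm] at hc
        rcases hc with rfl | hc
        · exact hwb
        · exact hw' c (List.mem_append.2 hc)
      · rw [binCost_append] at hc ⊢
        rw [binCost_cons]
        linarith
    rcases Nat.even_or_odd b.length with he | ho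
    · have hcost : binCost f (pairUp b) ≤ f b.length := by
        have h1 := hf b.length (by omega) (by omega)
        rw [binCost_pairUp, Nat.even_iff.1 he]
        have h2 : (b.length : ℚ) = 2 * (b.length / 2 : ℕ) := by
          have := Nat.even_iff.1 he
          exact_mod_cast (by omega : b.length = 2 * (b.length / 2))
        rw [h2] at h1
        push_cast
        linarith
      refine ⟨big, pairUp b ++ small, ?_, hbl, hb3, ?_, ?_, ?_⟩
      · refine List.Perm.trans ?_ (((pairUp_perm b).append_right _).trans (hp.append_left b))
        rw [List.flatten_append, List.flatten_append, List.flatten_append, ← List.append_assoc,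
          ← List.append_assoc]
        exact List.perm_append_comm.append_right _
      · intro c hc
        rcases List.mem_append.1 hc with hc | hc
        · exact length_of_mem_pairUp hc
        · exact hs c hc
      · intro c hc
        rw [List.mem_append, List.mem_append, or_left_comm] at hc
        rcases hc with hc | hc
        · exact weight_le_of_mem_pairUp_of_weight_le hwb hc
        · exact hw' c (List.mem_append.2 hc)
      · rw [binCost_append] at hc ⊢
        rw [binCost_append]
        linarith
    · have hodd := Nat.odd_iff.1 ho
      rcases big with _ | ⟨b', _ | ⟨b'', t⟩⟩
      · refine ⟨[b], small, ?_, le_rfl, ?_, hs, ?_, ?_⟩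
        · exact hp.append_left b
        · intro c hc
          rw [List.mem_singleton] at hc
          subst hc
          exact ⟨by omega, ho⟩
        · intro c hc
          rcases List.mem_cons.1 hc with rfl | hc
          · exact hwb
          · exact hw' c hc
        · rw [List.singleton_append, binCost_cons]
          rw [List.nil_append] at hc
          linarith
      · obtain ⟨h3', ho'⟩ := hb3 b' (by simp)
        have hodd' := Nat.odd_iff.1 ho'
        have hwb' := hw' b' (by simp)
        obtain ⟨e, r, hr, he⟩ := exists_perm_cons_small (C := C) (b := b) (by omega) hwb
        obtain ⟨e', r', hr', he'⟩ := exists_perm_cons_small (C := C) (b := b') (by omega) hwb'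
        have hlen := hr.length_eq
        have hlen' := hr'.length_eq
        have hpl := hp.length_eq
        rw [List.length_cons] at hlen hlen'
        rw [List.singleton_append, List.flatten_cons, List.length_append] at hpl
        -- The two small items form a pair. The remainders `r` and `r'` have even length, so
        -- everything in the two odd bins is packed in pairs, at cost `f 2 / 2` per item.
        refine ⟨[], [e, e'] :: (pairUp r ++ (pairUp r' ++ small)), ?_, by simp, by simp, ?_, ?_, ?_⟩
        · refine List.perm_iff_count.2 fun a => ?_
          have h1 := (pairUp_perm r).count_eq a
          have h2 := (pairUp_perm r').count_eq a
          have h3 := hr.count_eq a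
          have h4 := hr'.count_eq a
          have h5 := hp.count_eq a
          simp only [List.nil_append, List.singleton_append, List.flatten_cons, List.flatten_append,
            List.count_append, List.count_cons, List.count_nil] at *
          omega
        · intro c hc
          rcases List.mem_cons.1 hc with rfl | hc
          · exact .inr rfl
          · rcases List.mem_append.1 hc with hc | hc
            · exact length_of_mem_pairUp hc
            · rcases List.mem_append.1 hc with hc | hc
              · exact length_of_mem_pairUp hc
              · exact hs c hc
        · rw [weight_perm hr, weight_cons] at hwb
          rw [weight_perm hr', weight_cons] at hwb'
          intro c hc
          rcases List.mem_cons.1 hc with rfl | hc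
          · simp only [weight, List.map_cons, List.map_nil, List.sum_cons, List.sum_nil]
            omega
          · rcases List.mem_append.1 hc with hc | hc
            · exact weight_le_of_mem_pairUp_of_weight_le (by omega) hc
            · rcases List.mem_append.1 hc with hc | hc
              · exact weight_le_of_mem_pairUp_of_weight_le (by omega) hc
              · exact hw' c (List.mem_append_right _ hc)
        · have h1 := hf b.length (by omega) (by omega)
          have h2 := hf b'.length (by omega) (by omega)
          rw [List.singleton_append, binCost_cons] at hc
          rw [List.nil_append, binCost_cons, binCost_append, binCost_append, binCost_pairUp,
            binCost_pairUp]
          have h3 : (b.length : ℚ) = 2 * (r.length / 2 : ℕ) + 1 := by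
            exact_mod_cast (by omega : b.length = 2 * (r.length / 2) + 1)
          have h4 : (b'.length : ℚ) = 2 * (r'.length / 2 : ℕ) + 1 := by
            exact_mod_cast (by omega : b'.length = 2 * (r'.length / 2) + 1)
          rw [show r.length % 2 = 0 by omega, show r'.length % 2 = 0 by omega]
          rw [h3] at h1
          rw [h4] at h2
          simp only [List.length_cons, List.length_nil]
          push_cast
          norm_num
          linarith
      · simp only [List.length_cons] at hbl
        omega

theorem exists_candidate_le (f : ℕ → ℚ) {N : ℕ}
    (hf : ∀ j, 1 ≤ j → j ≤ N → (j : ℚ) * f 2 ≤ 2 * f j) {l : List Item} (hnd : l.Nodup)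
    (hl : l ≠ []) (hN : l.length ≤ N) {L : List (List Item)} (hne : [] ∉ L)
    (hp : L.flatten.Perm l) (hw : ∀ b ∈ L, weight b ≤ C) :
    ∃ M ∈ candidates C (sortItems C l), excess C M = 0 ∧ binCost f M ≤ binCost f L := by
  have hlen := hp.length_eq
  have hpos := List.length_pos_iff.2 hl
  obtain ⟨big, small, hp', hbl, hb3, hs, hw', hc⟩ := exists_special_form (C := C) f hf hne
    (by omega) hw
  have hf1 : f 2 ≤ 2 * f 1 := by simpa using hf 1 le_rfl (by omega)
  have hS := sortItems_perm (C := C) l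
  have hp'' := (hp'.trans hp).trans hS.symm
  -- Without an odd bin of three or more items, an arbitrary bin plays the role of the special one;
  -- there is one because `l` is not empty.
  obtain ⟨B, rest, hB, hBne, hrest⟩ : ∃ B rest, big ++ small = B :: rest ∧ B ≠ [] ∧
      ∀ b ∈ rest, b.length = 1 ∨ b.length = 2 := by
    rcases big with _ | ⟨b, _ | ⟨b', t⟩⟩
    · rcases small with _ | ⟨b, small⟩
      · have := (hp'.trans hp).length_eq
        simp only [List.append_nil, List.flatten_nil, List.length_nil] at this
        omega
      · refine ⟨b, small, rfl, ?_, fun c hc => hs c (by simp [hc])⟩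
        rintro rfl
        simpa using hs [] (by simp)
    · refine ⟨b, small, rfl, ?_, hs⟩
      rintro rfl
      simpa using hb3 [] (by simp)
    · simp only [List.length_cons] at hbl
      omega
  rw [hB] at hp'' hw' hc
  obtain ⟨M, hM, h1, h2⟩ := exists_candidate (hS.nodup_iff.2 hnd) (pairwise_sortItems l) hp'' hBne
    hw' hrest f hf1
  exact ⟨M, hM, h1, h2.trans hc⟩

/-! ### Selecting the cheapest candidate. -/

theorem foldr_argmin {α : Type} (k : α → ℕ) (d : α) (l : List α) :
    (l.foldr (fun a b => if k a ≤ k b then a else b) d ∈ d :: l) ∧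
      ∀ a ∈ l, k (l.foldr (fun a b => if k a ≤ k b then a else b) d) ≤ k a := by
  induction l with
  | nil => simp
  | cons a l ih =>
    rw [List.foldr_cons]
    obtain ⟨h1, h2⟩ := ih
    split_ifs with h
    · refine ⟨by simp, fun b hb => ?_⟩
      rcases List.mem_cons.1 hb with rfl | hb
      · exact le_rfl
      · exact h.trans (h2 b hb)
    · refine ⟨?_, fun b hb => ?_⟩
      · rcases List.mem_cons.1 h1 with h1 | h1
        · rw [h1]; simp
        · simp [h1]
      · rcases List.mem_cons.1 hb with rfl | hb
        · omega
        · exact h2 b hb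

/-- The singleton packing is the default of the fold. It is feasible by `hl`, so the result is a
feasible packing even if no candidate is. -/
theorem best_spec (g : List ℕ) {l : List Item} (hl : ∀ e ∈ l, e.1 ≤ C) :
    ((best C g l).flatten.Perm l ∧ [] ∉ best C g l ∧ ∀ b ∈ best C g l, weight b ≤ C) ∧
      ∀ M ∈ candidates C (sortItems C l), excess C M = 0 →
        listCost g (best C g l) ≤ listCost g M := by
  obtain ⟨h1, h2⟩ := foldr_argmin (listCost g) (l.map fun a => [a])
    ((candidates C (sortItems C l)).filter fun L => decide (excess C L = 0))
  refine ⟨?_, fun M hM hM0 => h2 M (List.mem_filter.2 ⟨hM, by simpa using hM0⟩)⟩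
  rcases List.mem_cons.1 h1 with h1 | h1
  · rw [best, h1, flatten_map_singleton]
    refine ⟨List.Perm.refl _, by simp, fun b hb => ?_⟩
    obtain ⟨a, ha, rfl⟩ := List.mem_map.1 hb
    simpa [weight] using hl a ha
  · obtain ⟨h1, h3⟩ := List.mem_filter.1 h1
    have h4 := candidates_spec h1
    exact ⟨h4.1.trans (sortItems_perm l), h4.2, excess_eq_zero.1 (of_decide_eq_true h3)⟩

theorem foldr_tail_eq_drop {α : Type} (g : List ℕ) (b : List α) :
    b.foldr (fun _ c => c.tail) g = g.drop b.length := by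
  induction b with
  | nil => rfl
  | cons a b ih => rw [List.foldr_cons, ih, List.tail_drop, List.length_cons]

end SpecialForm

/-! ### Packings as lists -/

namespace Instance

variable {I : Instance}

theorem Represents.cost_eq {L : List (List (Fin I.n))} {P : I.Packing} (h : I.Represents L P) :
    I.cost P = binCost I.f L := by
  rw [cost, Finset.sum, ← h.2, Multiset.map_coe, Multiset.sum_coe, List.map_map, binCost]
  congr 1
  refine List.map_congr_left fun b hb => ?_
  rw [Function.comp_apply, List.toFinset_card_of_nodup (h.1 b hb)]

theorem Represents.mem_parts {L : List (List (Fin I.n))} {P : I.Packing} (h : I.Represents L P)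
    {B : Finset (Fin I.n)} : B ∈ P.parts ↔ ∃ b ∈ L, b.toFinset = B := by
  rw [← Finset.mem_val, ← h.2, Multiset.mem_coe, List.mem_map]

theorem Represents.feasible_iff {L : List (List (Fin I.n))} {P : I.Packing}
    (h : I.Represents L P) : I.Feasible P ↔ ∀ b ∈ L, (b.map I.s).sum ≤ 1 := by
  constructor
  · intro hP b hb
    rw [← List.sum_toFinset _ (h.1 b hb)]
    exact hP _ (h.mem_parts.2 ⟨b, hb, rfl⟩)
  · intro hL B hB
    obtain ⟨b, hb, rfl⟩ := h.mem_parts.1 hB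
    rw [List.sum_toFinset _ (h.1 b hb)]
    exact hL b hb

theorem exists_list (P : I.Packing) : ∃ L : List (List (Fin I.n)), I.Represents L P ∧
    L.flatten.Perm (List.finRange I.n) ∧ [] ∉ L := by
  refine ⟨P.parts.toList.map Finset.toList, ⟨?_, ?_⟩, ?_, ?_⟩
  · intro b hb
    obtain ⟨B, -, rfl⟩ := List.mem_map.1 hb
    exact B.nodup_toList
  · rw [List.map_map]
    have : (List.toFinset ∘ Finset.toList : Finset (Fin I.n) → Finset (Fin I.n)) = _root_.id := by
      funext B
      simp
    rw [this, List.map_id, Finset.coe_toList]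
  · refine (List.perm_ext_iff_of_nodup ?_ (List.nodup_finRange _)).2 fun i => ?_
    · refine List.nodup_flatten.2 ⟨?_, ?_⟩
      · intro b hb
        obtain ⟨B, -, rfl⟩ := List.mem_map.1 hb
        exact B.nodup_toList
      · rw [List.pairwise_map]
        refine P.parts.nodup_toList.imp_of_mem fun {A B} hA hB hne i hiA hiB => ?_
        rw [Finset.mem_toList] at hA hB hiA hiB
        exact Finset.disjoint_left.1 (P.disjoint hA hB hne) hiA hiB
    · obtain ⟨B, hB, hi⟩ := P.exists_mem (Finset.mem_univ i)
      simp only [List.mem_finRange, iff_true, List.mem_flatten]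
      exact ⟨B.toList, List.mem_map.2 ⟨B, by simpa using hB, rfl⟩, by simpa using hi⟩
  · intro h
    obtain ⟨B, hB, h⟩ := List.mem_map.1 h
    rw [Finset.toList_eq_nil] at h
    subst h
    simp at hB

/-- Disjoint nonempty lists have distinct sets of entries, so the bins form a set without
repetition. -/
theorem exists_packing {L : List (List (Fin I.n))} (hL : L.flatten.Perm (List.finRange I.n))
    (hne : [] ∉ L) : ∃ P : I.Packing, I.Represents L P := by
  obtain ⟨hnd, hdis⟩ := List.nodup_flatten.1 (hL.nodup_iff.2 (List.nodup_finRange _))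
  have hdis' : (L.map List.toFinset).Pairwise fun A B => Disjoint A B := by
    rw [List.pairwise_map]
    refine hdis.imp fun {a b} h => Finset.disjoint_left.2 fun i hi hi' => ?_
    exact h (List.mem_toFinset.1 hi) (List.mem_toFinset.1 hi')
  have hbot : ∅ ∉ L.map List.toFinset := by
    intro h
    obtain ⟨b, hb, h⟩ := List.mem_map.1 h
    rw [List.toFinset_eq_empty_iff] at h
    exact hne (h ▸ hb)
  have hnodup : (L.map List.toFinset).Nodup := by
    refine hdis'.imp_of_mem fun {A B} hA hB h hAB => ?_
    subst hAB
    rw [disjoint_self] at h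
    exact hbot (Finset.bot_eq_empty (α := Fin I.n) ▸ h ▸ hA)
  refine ⟨⟨⟨L.map List.toFinset, hnodup⟩, ?_, ?_, ?_⟩, hnd, rfl⟩
  · rw [Finset.supIndep_iff_pairwiseDisjoint]
    intro A hA B hB hne
    have : Std.Symm fun A B : Finset (Fin I.n) => Disjoint A B := ⟨fun _ _ h => h.symm⟩
    exact hdis'.forall hA hB hne
  · refine Finset.eq_univ_iff_forall.2 fun i => ?_
    obtain ⟨b, hb, hi⟩ := List.mem_flatten.1 (hL.symm.subset (List.mem_finRange i))
    rw [Finset.mem_sup]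
    exact ⟨b.toFinset, List.mem_map.2 ⟨b, hb, rfl⟩, List.mem_toFinset.2 hi⟩
  · exact hbot

end Instance

end GCBP

/-! ### Correctness of the algorithm -/

namespace GCBP

open BitCost

/-- The numerator and the denominator. -/
def fraction (q : ℚ) : ℕ × ℕ := (q.num.natAbs, q.den)

theorem scale_ofFn {m : ℕ} (q : Fin m → ℚ) (hq : ∀ i, 0 ≤ q i) :
    0 < ((List.ofFn fun i => fraction (q i)).map fun x => x.2).prod ∧
    ∃ W : Fin m → ℕ, scale (List.ofFn fun i => fraction (q i)) = List.ofFn W ∧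
      ∀ i, (W i : ℚ) = q i * ((List.ofFn fun i => fraction (q i)).map fun x => x.2).prod := by
  have hmem : ∀ i, (q i).den ∈ (List.ofFn fun i => fraction (q i)).map fun x => x.2 := fun i =>
    List.mem_map.2 ⟨fraction (q i), List.mem_ofFn.2 ⟨i, rfl⟩, rfl⟩
  refine ⟨List.prod_pos fun a ha => ?_, fun i => (q i).num.natAbs *
    (((List.ofFn fun i => fraction (q i)).map fun x => x.2).prod / (q i).den), ?_, fun i => ?_⟩
  · obtain ⟨x, hx, rfl⟩ := List.mem_map.1 ha
    obtain ⟨i, rfl⟩ := List.mem_ofFn.1 hx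
    exact (q i).den_pos
  · rw [scale, List.map_ofFn]
    rfl
  · have hdvd := List.dvd_prod (hmem i)
    have hden : ((q i).den : ℚ) ≠ 0 := Nat.cast_ne_zero.2 (q i).den_nz
    rw [Nat.cast_mul, Nat.cast_div hdvd hden]
    have h1 : (((q i).num.natAbs : ℕ) : ℚ) = q i * (q i).den := by
      rw [Rat.mul_den_eq_num, ← Int.cast_natCast, Int.natAbs_of_nonneg (Rat.num_nonneg.2 (hq i))]
    rw [h1]
    field_simp

theorem zipIdx_ofFn {m : ℕ} (W : Fin m → ℕ) :
    (List.ofFn W).zipIdx = (List.finRange m).map fun i => (W i, (i : ℕ)) := by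
  refine List.ext_getElem (by simp) fun i h1 h2 => ?_
  simp

/-- The bound on the lengths ensures that the cost table has an entry for each bin, so that the
default value `0` is never used. -/
theorem listCost_eq {m : ℕ} (G : Fin m → ℕ) (f : ℕ → ℚ) (E : ℚ) (hG : ∀ i, (G i : ℚ) = f i * E)
    {L : List (List Item)} (hL : ∀ b ∈ L, b.length < m) :
    (listCost (List.ofFn G) L : ℚ) = binCost f L * E := by
  induction L with
  | nil => simp [listCost, binCost]
  | cons b L ih =>
    have hb := hL b (by simp)
    have h1 : listCost (List.ofFn G) (b :: L) = G ⟨b.length, hb⟩ + listCost (List.ofFn G) L := by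
      rw [listCost, List.map_cons, List.sum_cons, foldr_tail_eq_drop,
        List.drop_eq_getElem_cons (by simpa using hb)]
      simp [caseList, listCost]
    rw [h1, binCost_cons, Nat.cast_add, ih fun c hc => hL c (by simp [hc]), hG]
    ring

theorem length_le_of_mem {α : Type} {L : List (List α)} {b : List α} (hb : b ∈ L) :
    b.length ≤ L.flatten.length := by
  rw [List.length_flatten]
  exact List.single_le_sum (by simp) _ (List.mem_map_of_mem hb)

theorem binCost_map {α β : Type} (f : ℕ → ℚ) (φ : α → β) (L : List (List α)) :
    binCost f (L.map (List.map φ)) = binCost f L := by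
  simp [binCost, Function.comp_def]

/-- Transports bins of items (scaled size and label) back to bins of indices of the instance. -/
theorem exists_map_eq {α β : Type} {φ : α → β} (hφ : Function.Injective φ) {L : List (List β)}
    {l : List α} (h : L.flatten.Perm (l.map φ)) :
    ∃ M : List (List α), M.map (List.map φ) = L ∧ M.flatten.Perm l := by
  have h1 : L ∈ Set.range (List.map (List.map φ)) := by
    rw [Set.range_list_map, Set.range_list_map]
    intro b hb e he
    obtain ⟨a, -, ha⟩ := List.mem_map.1 (h.subset (List.mem_flatten.2 ⟨b, hb, he⟩))
    exact ⟨a, ha⟩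
  obtain ⟨M, rfl⟩ := h1
  refine ⟨M, rfl, ?_⟩
  rw [← List.map_flatten] at h
  exact (List.map_perm_map_iff hφ).1 h

/-! ### Scaling an instance to integers, and optimality of the answer. -/

namespace Instance

variable {I : Instance}

theorem f_nonneg {j : ℕ} (hj : j ≤ I.n) : 0 ≤ I.f j :=
  I.f_zero ▸ I.f_mono (Set.mem_Iic.2 (Nat.zero_le _)) (Set.mem_Iic.2 hj) (Nat.zero_le j)

theorem le_of_withMinimizer (hI : I ∈ withMinimizer 2) :
    2 ≤ I.n ∧ ∀ j, 1 ≤ j → j ≤ I.n → (j : ℚ) * I.f 2 ≤ 2 * I.f j := by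
  obtain ⟨⟨⟨-, h1⟩, h2⟩, -⟩ := hI
  refine ⟨h1, fun j hj hj' => ?_⟩
  have h := h2 j ⟨hj, hj'⟩
  have hj0 : (0 : ℚ) < j := by exact_mod_cast hj
  rw [div_le_div_iff₀ (by norm_num) hj0] at h
  push_cast at h
  linarith

/-- The instance as an input of the algorithm. -/
def input (I : Instance) : List (ℕ × ℕ) × List (ℕ × ℕ) :=
  (List.ofFn fun i : Fin I.n => fraction (I.s i),
    List.ofFn fun j : Fin (I.n + 1) => fraction (I.f j))

theorem enc_input (I : Instance) : Enc.enc I.input = I.encode := by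
  simp only [input, encode, Enc.enc, List.map_ofFn]
  rfl

/-- The sizes `W` are the sizes of the items, multiplied with a common denominator `D`. -/
structure IsScaling (I : Instance) (D : ℕ) (W : Fin I.n → ℕ) : Prop where
  pos : 0 < D
  eq : ∀ i, (W i : ℚ) = I.s i * D

/-- An item of the instance as an item of the algorithm. -/
def item (W : Fin I.n → ℕ) (i : Fin I.n) : Item := (W i, i)

theorem item_injective (W : Fin I.n → ℕ) : Function.Injective (item W) := fun _ _ h =>
  Fin.ext (congrArg Prod.snd h)

theorem IsScaling.weight_le_iff {D : ℕ} {W : Fin I.n → ℕ} (h : I.IsScaling D W)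
    (b : List (Fin I.n)) : weight (b.map (item W)) ≤ D ↔ (b.map I.s).sum ≤ 1 := by
  have h1 : (weight (b.map (item W)) : ℚ) = (b.map I.s).sum * D := by
    induction b with
    | nil => simp [weight]
    | cons i b ih =>
      rw [List.map_cons, weight_cons, Nat.cast_add, ih, List.map_cons, List.sum_cons, add_mul,
        ← h.eq i]
      rfl
  have hD : (0 : ℚ) < D := Nat.cast_pos.2 h.pos
  rw [← Nat.cast_le (α := ℚ), h1]
  constructor
  · intro h2
    by_contra! h3
    nlinarith
  · intro h2
    nlinarith

theorem exists_scaling (I : Instance) : ∃ (D E : ℕ) (W : Fin I.n → ℕ) (G : Fin (I.n + 1) → ℕ),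
    I.IsScaling D W ∧ 0 < E ∧ (∀ j, (G j : ℚ) = I.f j * E) ∧
      solve I.input =
        (best D (List.ofFn G) ((List.finRange I.n).map (item W))).map (List.map fun e => e.2) := by
  obtain ⟨hD, W, hW, hW'⟩ := scale_ofFn I.s I.s_nonneg
  obtain ⟨hE, G, hG, hG'⟩ := scale_ofFn (fun j : Fin (I.n + 1) => I.f j)
    fun j => f_nonneg (Nat.lt_succ_iff.1 j.2)
  refine ⟨_, _, W, G, ⟨hD, hW'⟩, hE, hG', ?_⟩
  rw [solve]
  simp only [input]
  rw [hW, hG, zipIdx_ofFn]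
  rfl

/-- The answer of the algorithm represents an optimal packing. -/
theorem solve_spec (hI : I ∈ withMinimizer 2) : ∃ L : List (List (Fin I.n)),
    solve I.input = L.map (List.map fun i : Fin I.n => (i : ℕ)) ∧
      ∃ P : I.Packing, I.Represents L P ∧ I.Optimal P := by
  obtain ⟨hn, hf⟩ := le_of_withMinimizer hI
  obtain ⟨D, E, W, G, hW, hE, hG, hsolve⟩ := exists_scaling I
  set l := (List.finRange I.n).map (item W) with hl
  have hlen : l.length = I.n := by simp [hl]
  have hlD : ∀ e ∈ l, e.1 ≤ D := by
    intro e he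
    obtain ⟨i, -, rfl⟩ := List.mem_map.1 he
    have := (hW.weight_le_iff [i]).2 (by simpa using I.s_le_one i)
    simpa [weight] using this
  obtain ⟨⟨h1, h2, h3⟩, h4⟩ := best_spec (List.ofFn G) hlD
  obtain ⟨L, hL, hLp⟩ := exists_map_eq (item_injective W) h1
  rw [← hL] at h2 h3 h4 hsolve
  have hLne : [] ∉ L := fun h => h2 (List.mem_map.2 ⟨[], h, rfl⟩)
  obtain ⟨P, hP⟩ := exists_packing hLp hLne
  refine ⟨L, ?_, P, hP, hP.feasible_iff.2 fun b hb => ?_, fun Q hQ => ?_⟩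
  · rw [hsolve, List.map_map]
    refine List.map_congr_left fun b _ => ?_
    rw [Function.comp_apply, List.map_map]
    rfl
  · exact (hW.weight_le_iff b).1 (h3 _ (List.mem_map_of_mem hb))
  · obtain ⟨M, hM, hMp, hMne⟩ := exists_list Q
    have hnd : l.Nodup := (List.nodup_finRange _).map (item_injective W)
    have hMp' : (M.map (List.map (item W))).flatten.Perm l := by
      rw [← List.map_flatten]
      exact hMp.map _
    -- For every feasible packing `Q`, some feasible candidate `K` costs no more, and the answer
    -- costs no more than `K`.
    obtain ⟨K, hK, hK0, hKc⟩ := exists_candidate_le (C := D) I.f hf hnd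
      (by rintro h; rw [h] at hlen; simp at hlen; omega) hlen.le
      (L := M.map (List.map (item W))) (by simpa using hMne) hMp' (fun b hb => by
        obtain ⟨b, hb', rfl⟩ := List.mem_map.1 hb
        exact (hW.weight_le_iff b).2 (hM.feasible_iff.1 hQ b hb'))
    have hle := h4 K hK hK0
    have hKp := (candidates_spec hK).1.trans (sortItems_perm l)
    have hlt : ∀ N : List (List Item), N.flatten.Perm l → ∀ b ∈ N, b.length < I.n + 1 := by
      intro N hN b hb
      have h5 := length_le_of_mem hb
      have h6 := hN.length_eq
      omega
    rw [← Nat.cast_le (α := ℚ), listCost_eq G I.f E hG (hlt _ (hL ▸ h1)),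
      listCost_eq G I.f E hG (hlt _ hKp)] at hle
    have hle := le_of_mul_le_mul_right hle (Nat.cast_pos.2 hE)
    rw [binCost_map] at hle hKc
    rw [hP.cost_eq, hM.cost_eq]
    exact hle.trans hKc

/-- An optimal packing exists because the algorithm produces one. Bringing it into special form
keeps it feasible and does not raise its cost, hence keeps it optimal. -/
theorem exists_optimal_special (hI : I ∈ withMinimizer 2) : ∃ P : I.Packing, I.Optimal P ∧
    (∀ B ∈ P.parts, B.card = 1 ∨ B.card = 2 ∨ (3 ≤ B.card ∧ Odd B.card)) ∧
    (P.parts.filter fun B => 3 ≤ B.card).card ≤ 1 := by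
  obtain ⟨-, -, Q, -, hQ, hopt⟩ := solve_spec hI
  obtain ⟨hn, hf⟩ := le_of_withMinimizer hI
  obtain ⟨D, -, W, -, hW, -⟩ := exists_scaling I
  obtain ⟨M, hM, hMp, hMne⟩ := exists_list Q
  have hMp' : (M.map (List.map (item W))).flatten.Perm ((List.finRange I.n).map (item W)) := by
    rw [← List.map_flatten]
    exact hMp.map _
  obtain ⟨big, small, hp, hbl, hb3, hs, hw, hc⟩ := exists_special_form (C := D) I.f hf
    (L := M.map (List.map (item W))) (by simpa using hMne) (by rw [hMp'.length_eq]; simp)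
    (fun b hb => by
      obtain ⟨b, hb', rfl⟩ := List.mem_map.1 hb
      exact (hW.weight_le_iff b).2 (hM.feasible_iff.1 hQ b hb'))
  obtain ⟨L, hL, hLp⟩ := exists_map_eq (item_injective W) (hp.trans hMp')
  obtain ⟨big, small, rfl, rfl, rfl⟩ := List.map_eq_append_iff.1 hL
  simp only [List.mem_map, forall_exists_index, and_imp, forall_apply_eq_imp_iff₂,
    List.length_map] at hbl hb3 hs
  rw [← List.map_append] at hw hc
  have hne : [] ∉ big ++ small := by
    intro h
    rcases List.mem_append.1 h with h | h
    · simpa using hb3 [] h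
    · simpa using hs [] h
  obtain ⟨P, hP⟩ := exists_packing hLp hne
  refine ⟨P, ⟨hP.feasible_iff.2 fun b hb => ?_, fun R hR => ?_⟩, fun B hB => ?_, ?_⟩
  · exact (hW.weight_le_iff b).1 (hw _ (List.mem_map_of_mem hb))
  · rw [binCost_map, binCost_map, ← hP.cost_eq, ← hM.cost_eq] at hc
    exact hc.trans (hopt R hR)
  · obtain ⟨b, hb, rfl⟩ := hP.mem_parts.1 hB
    rw [List.toFinset_card_of_nodup (hP.1 b hb)]
    rcases List.mem_append.1 hb with hb | hb
    · exact .inr (.inr (hb3 b hb))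
    · exact (hs b hb).imp_right .inl
  -- Bins with three or more items can only come from `big`, which has at most one entry.
  · have hsub : (P.parts.filter fun B => 3 ≤ B.card) ⊆ (big.map List.toFinset).toFinset := by
      intro B hB
      obtain ⟨hB, h3⟩ := Finset.mem_filter.1 hB
      obtain ⟨b, hb, rfl⟩ := hP.mem_parts.1 hB
      rw [List.toFinset_card_of_nodup (hP.1 b hb)] at h3
      rcases List.mem_append.1 hb with hb | hb
      · exact List.mem_toFinset.2 (List.mem_map_of_mem hb)
      · have := hs b hb
        omega
    calc _ ≤ _ := Finset.card_le_card hsub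
      _ ≤ (big.map List.toFinset).length := List.toFinset_card_le _
      _ ≤ 1 := by rwa [List.length_map]

end Instance

theorem polyTimeSolvable : PolyTimeSolvable Instance.encode Instance.encodeBins (withMinimizer 2)
    (fun I L => ∃ P : I.Packing, I.Represents L P ∧ I.Optimal P) := by
  obtain ⟨p, P, h⟩ := polyTime_solve
  refine ⟨p, P, fun I hI => ?_⟩
  obtain ⟨L, hL, hopt⟩ := Instance.solve_spec hI
  obtain ⟨t, ht, hP⟩ := h I.input
  refine ⟨L, t, hopt, ?_, ?_⟩
  · have henc : Enc.enc (solve I.input) = I.encodeBins L := by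
      rw [hL]
      simp only [Instance.encodeBins, Enc.enc, List.map_map, Function.comp_def,
        List.bind_eq_flatMap, List.pure_def, ← List.map_eq_flatMap]
    rwa [I.enc_input, henc] at ht
  · rwa [esize, I.enc_input] at hP

end GCBP

/-- Restricted to the instances for which the smallest minimizer of `f j / j` is `2`, every
instance has an optimal packing all of whose bins have one or two items, except for at most one bin
of odd cardinality at least `3`, and an optimal packing can be computed in polynomial time. -/
theorem mainTheorem3 :
    (∀ I ∈ GCBP.withMinimizer 2, ∃ P : I.Packing, I.Optimal P ∧
      (∀ B ∈ P.parts, B.card = 1 ∨ B.card = 2 ∨ (3 ≤ B.card ∧ Odd B.card)) ∧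
      (P.parts.filter fun B => 3 ≤ B.card).card ≤ 1) ∧
    BitCost.PolyTimeSolvable GCBP.Instance.encode GCBP.Instance.encodeBins
      (GCBP.withMinimizer 2)
      (fun I L => ∃ P : I.Packing, I.Represents L P ∧ I.Optimal P) := by
  exact ⟨fun I hI => GCBP.Instance.exists_optimal_special hI, GCBP.polyTimeSolvable⟩
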